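/- Let $k$ be an algebraically closed field with a nontrivial valuation $\mathrm{val}\colon k\to\mathbb{R}\cup\{+\infty\}$, and let $\mathrm{trop}\colon (k^*)^2\to\mathbb{R}^2$, $(x,y)\mapsto(-\mathrm{val}(x),-\mathrm{val}(y))$. For a Laurent polynomial $f=\sum_{\mathbf i\in\mathbb{Z}^2} c_{\mathbf i}\mathbf{x}^{\mathbf i}\in k[x^{\pm1},y^{\pm1}]$ let $\mathrm{trop}(f)$ be the tropical polynomial with coefficients $-\mathrm{val}(c_{\mathbf i})\in\mathbb{R}\cup\{-\infty\}$. For a tropical polynomial $\mathcal F=\bigoplus_{\mathbf i}\alpha_{\mathbf i}\mathbf{x}^{\mathbf i}$ (with $\alpha_{\mathbf i}\in\mathbb{R}\cup\{-\infty\}$, all but finitely many equal to $-\infty$) let $\mathcal F(P)=\max_{\mathbf i}(\alpha_{\mathbf i}+\mathbf i\cdot P)$ for $P\in\mathbb{R}^2$, and let $V(\mathcal F)\subset\mathbb{R}^2$ be the set of points $P$ at which this maximum is attained by at least two exponents $\mathbf i$ (so $V(-\infty)=\mathbb{R}^2$). The edges of $V(\mathcal F)$ are its closed $1$-dimensional cells,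 dual to the $1$-dimensional cells of the dual subdivision of $\mathcal F$ (for $\mathcal F=-\infty$ there are none). The multiplicity $m_L$ of an edge $L$ is the lattice length of the dual $1$-dimensional cell, and $\mathbf v_L$ denotes a primitive integer vector in the direction of $L$. For tropical polynomials $\mathcal F,\mathcal G$, the intersection multiplicity of $V(\mathcal F)$ and $V(\mathcal G)$ at a point $P\in V(\mathcal F)\cap V(\mathcal G)$ is $$i(P)=\sum_{L_1\ni P,\;L_2\ni P}\ \sum_{Q\in(L_1+\varepsilon\mathbf v)\cap L_2} m_{L_1}m_{L_2}\,|\det(\mathbf v_{L_1},\mathbf v_{L_2})|,$$ where $L_1$ and $L_2$ run over the edges of $V(\mathcal F)$ and of $V(\mathcal G)$ containing $P$, the vector $\mathbf v\in\mathbb{R}^2$ is generic, and $\varepsilon\ne0$ is sufficiently small; this does not depend on the choice of $\mathbf v$ and $\varepsilon$. The stable intersection of $V(\mathcal F)$ and $V(\mathcal G)$ is $\lim_{\varepsilon\to0}\bigl((V(\mathcal F)+\varepsilon\mathbf v)\cap V(\mathcal G)\bigr)$ for generic $\mathbf v$. The intersection multiplicity on a connected component $C$ of $V(\mathcal F)\cap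 V(\mathcal G)$ is the sum of $i(P)$ over the points $P$ of the stable intersection that lie on $C$. Let $\mathcal R_1(f,g)$ be the set of rays $L\subset\mathbb{R}^2$ such that $L$ is a connected component of $V(\mathrm{trop}(f))\cap V(\mathrm{trop}(g))$ and the intersection multiplicity of $V(\mathrm{trop}(f))$ and $V(\mathrm{trop}(g))$ on $L$ is $1$. Let $f,g\in k[x^{\pm1},y^{\pm1}]$ be Laurent polynomials and let $L\in\mathcal R_1(f,g)$. Let $V(f,g)\subset(k^*)^2$ be the set of common zeros of $f$ and $g$. Then the set $\mathrm{trop}(V(f,g))\cap L$ has at most one point. -/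

import Mathlib

noncomputable section

open scoped Topology Pointwise

namespace TropicalCurve

/-! ### Tropical polynomials and tropical plane curves -/

/-- A bivariate tropical (Laurent) polynomial `⨁ αᵢ xⁱ`, `i ∈ ℤ²`, over the max-plus semifield
`𝕋 = ℝ ∪ {-∞}`: all but finitely many of the coefficients are `-∞ = ⊥`. -/
@[ext] structure TropPoly where
  /-- The coefficients. -/
  coeff : ℤ × ℤ → WithBot ℝ
  finite_ne_bot : {i | coeff i ≠ ⊥}.Finite

/-- The inclusion `ℤ² ⊆ ℝ²`. -/
def toPlane (i : ℤ × ℤ) : ℝ × ℝ := ((i.1 : ℝ), (i.2 : ℝ))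

namespace TropPoly

variable (F G : TropPoly)

/-- The exponents `i` with `αᵢ ≠ -∞`. -/
def support : Finset (ℤ × ℤ) := F.finite_ne_bot.toFinset

/-- The value `αᵢ + i · P` at `P` of the term with exponent `i`. -/
def term (i : ℤ × ℤ) (P : ℝ × ℝ) : WithBot ℝ :=
  F.coeff i + ((i.1 * P.1 + i.2 * P.2 : ℝ) : WithBot ℝ)

/-- The value `F(P) = maxᵢ (αᵢ + i · P)`. -/
def eval (P : ℝ × ℝ) : WithBot ℝ := F.support.sup fun i => F.term i P

/-- The tropical hypersurface `V(F) ⊆ ℝ²`: the points where the maximum is attained by at least two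
terms. (If all coefficients are `-∞`, this is all of `ℝ²`.) -/
def hypersurface : Set (ℝ × ℝ) :=
  {P | ∃ i j : ℤ × ℤ, i ≠ j ∧ F.term i P = F.eval P ∧ F.term j P = F.eval P}

open scoped Classical in
/-- The exponents of the terms that attain the maximum at `P`. The points `(i, αᵢ)` with `i` in this
set are those on the face of the upper hull of all `(i, αᵢ)` on which the functional `(P, 1)`
is maximal; these are exactly the bounded faces of `conv {(i, α) | α ≤ αᵢ}`. So
the cells of the dual subdivision of `F` are the convex hulls of the sets `F.maxTerms P`, and
distinct sets have distinct convex hulls. -/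
def maxTerms (P : ℝ × ℝ) : Finset (ℤ × ℤ) := {i ∈ F.support | F.term i P = F.eval P}

open scoped Classical in
/-- The `1`-dimensional cells of the dual subdivision of `F`. A cell is recorded by the set `A` of
those exponents whose lifts lie on the corresponding face of the upper hull; the cell itself is the
segment `conv A`. -/
def dualSegments : Finset (Finset (ℤ × ℤ)) :=
  {A ∈ F.support.powerset |
    (∃ P, A = F.maxTerms P) ∧ A.Nontrivial ∧ Collinear ℝ (toPlane '' (A : Set (ℤ × ℤ)))}

/-- The cell of the tropical curve `V(F)` dual to the cell `conv A` of the dual subdivision. For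
`A ∈ F.dualSegments` these are the edges (`1`-dimensional closed cells) of `V(F)`. -/
def dualCell (A : Finset (ℤ × ℤ)) : Set (ℝ × ℝ) := {P | A ⊆ F.maxTerms P}

end TropPoly

/-- The lattice length of the segment `conv A`, for a finite collinear set `A ⊆ ℤ²`. (The lattice
length of the segment between the lattice points `a` and `b` is the `gcd` of the coordinates of
`b - a`; the maximum is attained at the two endpoints of `conv A`.) For `A ∈ F.dualSegments` this is
the multiplicity of the edge `F.dualCell A` of `V(F)`. -/
def latticeLength (A : Finset (ℤ × ℤ)) : ℕ :=
  A.sup fun a => A.sup fun b => Int.gcd (b.1 - a.1) (b.2 - a.2)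

/-- The primitive integer vector, well defined up to sign, orthogonal to the segment `conv A`. For
`A ∈ F.dualSegments` this is the primitive vector in the direction of the edge `F.dualCell A`. -/
def edgeVector (A : Finset (ℤ × ℤ)) : ℤ × ℤ :=
  Classical.epsilon fun v : ℤ × ℤ => Int.gcd v.1 v.2 = 1 ∧
    ∀ a ∈ A, ∀ b ∈ A, v.1 * (b.1 - a.1) + v.2 * (b.2 - a.2) = 0

/-- The intersection multiplicity `m₁ m₂ |det (v₁, v₂)|` of two edges, dual to `conv A` and `conv B`,
at a transverse intersection point. It is `0` for parallel edges. -/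
def transverseMultiplicity (A B : Finset (ℤ × ℤ)) : ℕ :=
  latticeLength A * latticeLength B *
    ((edgeVector A).1 * (edgeVector B).2 - (edgeVector A).2 * (edgeVector B).1).natAbs

/-! ### Intersection multiplicities and stable intersection -/

/-- The filter of generic vectors of `ℝ²`: a property holds for generic `v` if it holds for all `v`
outside some finite union of lines through the origin. -/
def genericVectors : Filter (ℝ × ℝ) :=
  ⨅ a ∈ ({0}ᶜ : Set (ℝ × ℝ)), Filter.principal {v | a.1 * v.1 + a.2 * v.2 ≠ 0}

/-- The filter of generic small displacements: a property of `w` holds eventually along it if, for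
generic `v`, it holds for `w = ε v` for all sufficiently small `ε ≠ 0`. -/
def genericDisplacements : Filter (ℝ × ℝ) :=
  Filter.bind genericVectors fun v => Filter.map (fun ε : ℝ => ε • v) (𝓝[≠] (0 : ℝ))

namespace TropPoly

variable (F G : TropPoly)

open scoped Classical in
/-- The sum, over the edges `L₁ ∋ P` of `V(F)` and `L₂ ∋ P` of `V(G)`, of the numbers of points of
`(L₁ + w) ∩ L₂`, each counted with its transverse multiplicity. -/
def displacedCount (P w : ℝ × ℝ) : ℕ :=
  ∑ A ∈ F.dualSegments with P ∈ F.dualCell A, ∑ B ∈ G.dualSegments with P ∈ G.dualCell B,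
    Set.ncard ((w +ᵥ F.dualCell A) ∩ G.dualCell B) * transverseMultiplicity A B

/-- The intersection multiplicity `i(P; V(F) · V(G))`: the value of the displaced count for generic
`v` and `w = ε v` with `ε ≠ 0` sufficiently small. The count is eventually constant along the filter
of generic small displacements, and its limit superior is that constant. -/
def intersectionMultiplicity (P : ℝ × ℝ) : ℕ :=
  Filter.limsup (fun w => displacedCount F G P w) genericDisplacements

/-- The stable intersection: the limit of `(V(F) + ε v) ∩ V(G)` for `ε → 0` and generic `v`, that is,
the set of the points near which there are points of `(V(F) + ε v) ∩ V(G)` for all small `ε ≠ 0`. -/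
def stableIntersection : Set (ℝ × ℝ) :=
  {P | ∀ U ∈ 𝓝 P, ∀ᶠ w in genericDisplacements,
    (((w +ᵥ F.hypersurface) ∩ G.hypersurface) ∩ U).Nonempty}

/-- The intersection multiplicity of `V(F)` and `V(G)` on a connected component `C` of their
intersection: the sum of the multiplicities of the stable intersection points on `C`. -/
def multiplicityOn (C : Set (ℝ × ℝ)) : ℕ :=
  ∑ᶠ P ∈ stableIntersection F G ∩ C, intersectionMultiplicity F G P

end TropPoly

/-- `L` is a (closed) ray in `ℝ²`. -/
def IsRay (L : Set (ℝ × ℝ)) : Prop :=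
  ∃ p v : ℝ × ℝ, v ≠ 0 ∧ L = {x | ∃ t : ℝ, 0 ≤ t ∧ x = p + t • v}

/-- `𝓡₁(F, G)`: the rays that are connected components of `V(F) ∩ V(G)` on which the intersection
multiplicity of `V(F)` and `V(G)` is `1`. -/
def raysOne (F G : TropPoly) : Set (Set (ℝ × ℝ)) :=
  {L | IsRay L ∧
    (∃ x ∈ F.hypersurface ∩ G.hypersurface,
      L = connectedComponentIn (F.hypersurface ∩ G.hypersurface) x) ∧
    F.multiplicityOn G L = 1}

/-! ### Tropicalization -/

/-- Bivariate Laurent polynomials `k[x^{±1}, y^{±1}]`. -/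
abbrev Laurent (k : Type*) [Field k] : Type _ := AddMonoidAlgebra k (ℤ × ℤ)

section Tropicalization

variable {k : Type*} [Field k] (val : AddValuation k (WithTop ℝ))

open scoped Classical in
/-- `trop f = ⨁ (-val cᵢ) xⁱ` for `f = ∑ cᵢ xⁱ`, with `-val 0 = -∞`. -/
def tropPoly (f : Laurent k) : TropPoly where
  coeff i := if f.coeff i = 0 then ⊥ else ((-((val (f.coeff i)).untopD 0) : ℝ) : WithBot ℝ)
  finite_ne_bot := f.coeff.support.finite_toSet.subset fun _ hi =>
    Finsupp.mem_support_iff.2 fun h => hi (if_pos h)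

/-- The tropicalization map `(k^*)² → ℝ²`, `(x, y) ↦ (-val x, -val y)`. (The valuation of a unit
is finite, so the default value is never used.) -/
def trop (z : kˣ × kˣ) : ℝ × ℝ :=
  (-((val (z.1 : k)).untopD 0), -((val (z.2 : k)).untopD 0))

/-- The value of a Laurent polynomial at a point of `(k^*)²`. -/
def evalAt (f : Laurent k) (z : kˣ × kˣ) : k :=
  f.coeff.sum fun i c => c * ((z.1 ^ i.1 * z.2 ^ i.2 : kˣ) : k)

/-- `V(f, g) ⊆ (k^*)²`, the set of common zeros. -/
def zeroLocus (f g : Laurent k) : Set (kˣ × kˣ) := {z | evalAt f z = 0 ∧ evalAt g z = 0}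

end Tropicalization

end TropicalCurve

end

open scoped Topology Pointwise

noncomputable section

namespace TropicalCurve

/-! Write `L = p + ℝ≥0 v`, and let `F`, `G` be the tropicalizations of `f`, `g`. The proof has a
combinatorial and an algebraic half.

Combinatorics. If both curves went straight through `p`, the component would extend beyond `p` in
the direction `-v`; hence one of them has a vertex at `p` (`isVertex_or_isVertex`). Any vertex of
either curve on `L` is a stable intersection point of positive multiplicity, because after a small
displacement an edge leaving the ray there crosses the other curve. The total being one, there is no
vertex elsewhere on `L` (`not_isVertex_of_pos`), and two vertices at `p` would already give
multiplicity two (`two_le_intersectionMultiplicity`). Say the vertex belongs to `V(F)`. Then `V(G)`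
is a straight edge at `p`, and every edge of `V(F)` on a fixed side of `L` contributes its product
`m₁ m₂ |det|`. So there is exactly one such edge, and all three factors are one. This makes the
polygon dual to `p` have width one along `L`, with a single exponent opposite to the ray
(`exists_localModel`).

Algebra. Choose monomial coordinates `u`, `y` such that `val y` is constant on `L` and `val u` grows
strictly away from `p`. Up to monomial factors, the dominant part of `g` is `c₀ + c₁ y`, and that of
`f` is a Laurent polynomial in `y` plus one term `c u y^m`. Subtract the equations at two common
zeros with tropicalization on `L`. Given a common bound on the relative distances of the
coordinates, `g` improves the bound for `y` (`lt_val_sub_of_dominant_pair`), and then `f` improves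
the one for `u` (`lt_val_sub_of_dominant_linear`). No bound can be sharp, so the `u`-coordinates
agree, and `val u` determines the point of `L`. -/

/-- The pairing of an exponent with a vector of the plane. -/
def dot (i : ℤ × ℤ) (P : ℝ × ℝ) : ℝ := i.1 * P.1 + i.2 * P.2

lemma dot_add (i : ℤ × ℤ) (P Q : ℝ × ℝ) : dot i (P + Q) = dot i P + dot i Q := by
  simp only [dot, Prod.fst_add, Prod.snd_add]; ring

lemma dot_smul (i : ℤ × ℤ) (t : ℝ) (P : ℝ × ℝ) : dot i (t • P) = t * dot i P := by
  simp only [dot, Prod.smul_fst, Prod.smul_snd, smul_eq_mul]; ring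

lemma dot_neg (i : ℤ × ℤ) (P : ℝ × ℝ) : dot i (-P) = -dot i P := by
  simp only [dot, Prod.fst_neg, Prod.snd_neg]; ring

lemma dot_sub (i : ℤ × ℤ) (P Q : ℝ × ℝ) : dot i (P - Q) = dot i P - dot i Q := by
  simp only [dot, Prod.fst_sub, Prod.snd_sub]; ring

/-- The determinant of two vectors of the plane. -/
def cross (d e : ℝ × ℝ) : ℝ := d.1 * e.2 - d.2 * e.1

lemma exists_eq_smul_of_cross_eq_zero {d e : ℝ × ℝ} (hd : d ≠ 0) (h : cross d e = 0) :
    ∃ c : ℝ, e = c • d := by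
  have hs : 0 < d.1 ^ 2 + d.2 ^ 2 := by
    by_contra hn
    apply hd
    ext
    · simp only [Prod.fst_zero]; nlinarith [sq_nonneg d.1, sq_nonneg d.2]
    · simp only [Prod.snd_zero]; nlinarith [sq_nonneg d.1, sq_nonneg d.2]
  unfold cross at h
  refine ⟨(d.1 * e.1 + d.2 * e.2) / (d.1 ^ 2 + d.2 ^ 2), ?_⟩
  ext
  · simp only [Prod.smul_fst, smul_eq_mul]
    field_simp
    linear_combination (-d.2) * h
  · simp only [Prod.smul_snd, smul_eq_mul]
    field_simp
    linear_combination d.1 * h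

/-- Two vectors orthogonal to a common nonzero lattice vector are parallel. -/
lemma cross_eq_zero_of_dot_eq {a b : ℤ × ℤ} (hab : a ≠ b) {d e : ℝ × ℝ}
    (hd : dot a d = dot b d) (he : dot a e = dot b e) : cross d e = 0 := by
  unfold dot at hd he
  unfold cross
  have h1 : ((a.1 : ℝ) - b.1) * (d.1 * e.2 - d.2 * e.1) = 0 := by
    linear_combination e.2 * hd - d.2 * he
  have h2 : ((a.2 : ℝ) - b.2) * (d.1 * e.2 - d.2 * e.1) = 0 := by
    linear_combination d.1 * he - e.1 * hd
  by_contra hn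
  apply hab
  ext
  · have := (mul_eq_zero.1 h1).resolve_right hn
    exact_mod_cast sub_eq_zero.1 this
  · have := (mul_eq_zero.1 h2).resolve_right hn
    exact_mod_cast sub_eq_zero.1 this

/-- Coordinates with respect to two independent vectors. -/
lemma exists_coords {v n : ℝ × ℝ} (h : cross v n ≠ 0) (w : ℝ × ℝ) :
    ∃ x y : ℝ, w = x • n + y • v := by
  unfold cross at h
  refine ⟨(v.1 * w.2 - v.2 * w.1) / (v.1 * n.2 - v.2 * n.1),
    (w.1 * n.2 - w.2 * n.1) / (v.1 * n.2 - v.2 * n.1), ?_⟩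
  ext
  · simp only [Prod.fst_add, Prod.smul_fst, smul_eq_mul]; field_simp; ring
  · simp only [Prod.snd_add, Prod.smul_snd, smul_eq_mul]; field_simp; ring

/-! ### Faces of finite sets of exponents -/

open scoped Classical in
/-- The exponents of `M` on which `d` is maximal. -/
def face (M : Finset (ℤ × ℤ)) (d : ℝ × ℝ) : Finset (ℤ × ℤ) :=
  {i ∈ M | ∀ j ∈ M, dot j d ≤ dot i d}

lemma mem_face {M : Finset (ℤ × ℤ)} {d : ℝ × ℝ} {i : ℤ × ℤ} :
    i ∈ face M d ↔ i ∈ M ∧ ∀ j ∈ M, dot j d ≤ dot i d := by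
  simp [face]

lemma face_dot_eq {M : Finset (ℤ × ℤ)} {d : ℝ × ℝ} {i j : ℤ × ℤ} (hi : i ∈ face M d)
    (hj : j ∈ face M d) : dot i d = dot j d :=
  le_antisymm ((mem_face.1 hj).2 i (mem_face.1 hi).1) ((mem_face.1 hi).2 j (mem_face.1 hj).1)

lemma face_eq_self {M : Finset (ℤ × ℤ)} {d : ℝ × ℝ} (h : ∀ i ∈ M, ∀ j ∈ M, dot i d = dot j d) :
    face M d = M := by
  ext i
  exact ⟨fun hi => (mem_face.1 hi).1, fun hi => mem_face.2 ⟨hi, fun j hj => (h j hj i hi).le⟩⟩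

lemma face_nonempty {M : Finset (ℤ × ℤ)} (hM : M.Nonempty) (d : ℝ × ℝ) : (face M d).Nonempty := by
  obtain ⟨i, hi, h⟩ := M.exists_max_image (fun i => dot i d) hM
  exact ⟨i, mem_face.2 ⟨hi, h⟩⟩

/-- If `v` is not constant on `M`, then some direction `n + s v` selects a face that joins the
face in direction `v` to the rest of `M`. -/
lemma exists_adjacent_face {M : Finset (ℤ × ℤ)} {v : ℝ × ℝ} (n : ℝ × ℝ)
    (h : ∃ i ∈ M, ∃ j ∈ M, dot i v ≠ dot j v) :
    ∃ s : ℝ, ∃ i ∈ face M v, ∃ j ∈ M, dot j v < dot i v ∧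
      i ∈ face M (n + s • v) ∧ j ∈ face M (n + s • v) := by
  classical
  obtain ⟨a, ha, b, hb, hab⟩ := h
  -- For large `s` the functional `n + s v` is maximal at `i`. As `s` decreases, `j` is the first
  -- exponent outside the face to catch up, and the quotient below is the value of `s` at which it
  -- ties with `i`.
  obtain ⟨i, hi, him⟩ := (face M v).exists_max_image (fun i => dot i n) (face_nonempty ⟨a, ha⟩ v)
  have hi' := mem_face.1 hi
  obtain ⟨j, hj, hjm⟩ := (M.filter fun j => dot j v < dot i v).exists_max_image
    (fun j => (dot j n - dot i n) / (dot i v - dot j v)) (by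
      rcases lt_or_gt_of_ne hab with hl | hl
      · exact ⟨a, Finset.mem_filter.2 ⟨ha, hl.trans_le (hi'.2 b hb)⟩⟩
      · exact ⟨b, Finset.mem_filter.2 ⟨hb, hl.trans_le (hi'.2 a ha)⟩⟩)
  obtain ⟨hjM, hjv⟩ := Finset.mem_filter.1 hj
  set s := (dot j n - dot i n) / (dot i v - dot j v) with hs
  have hpos : 0 < dot i v - dot j v := by linarith
  have hij : dot j (n + s • v) = dot i (n + s • v) := by
    simp only [dot_add, dot_smul]
    have : s * (dot i v - dot j v) = dot j n - dot i n := by rw [hs]; field_simp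
    linarith
  have hmax : ∀ k ∈ M, dot k (n + s • v) ≤ dot i (n + s • v) := by
    intro k hk
    simp only [dot_add, dot_smul]
    rcases (hi'.2 k hk).lt_or_eq with hl | he
    · have := hjm k (Finset.mem_filter.2 ⟨hk, hl⟩)
      rw [div_le_iff₀ (by linarith)] at this
      linarith
    · have := him k (mem_face.2 ⟨hk, fun l hl => he ▸ hi'.2 l hl⟩)
      rw [he]; linarith
  exact ⟨s, i, hi, j, hjM, hjv, mem_face.2 ⟨hi'.1, hmax⟩, mem_face.2 ⟨hjM, fun k hk => hij ▸ hmax k hk⟩⟩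

/-! ### Edges of a tropical curve at a point -/

namespace TropPoly

variable {F G : TropPoly} {P d e v n : ℝ × ℝ} {A B : Finset (ℤ × ℤ)}

/-- The value at `P` of the term with exponent `i` of the support, as a real number. -/
def realTerm (F : TropPoly) (i : ℤ × ℤ) (P : ℝ × ℝ) : ℝ := (F.coeff i).unbotD 0 + dot i P

lemma mem_support {i : ℤ × ℤ} : i ∈ F.support ↔ F.coeff i ≠ ⊥ := by simp [support]

lemma term_eq_realTerm {i : ℤ × ℤ} (hi : i ∈ F.support) (P : ℝ × ℝ) :
    F.term i P = (F.realTerm i P : WithBot ℝ) := by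
  obtain ⟨c, hc⟩ := WithBot.ne_bot_iff_exists.1 (mem_support.1 hi)
  simp [term, realTerm, dot, ← hc]

lemma mem_maxTerms {i : ℤ × ℤ} :
    i ∈ F.maxTerms P ↔ i ∈ F.support ∧ ∀ j ∈ F.support, F.realTerm j P ≤ F.realTerm i P := by
  simp only [maxTerms, Finset.mem_filter]
  refine and_congr_right fun hi => ?_
  have h1 : F.term i P ≤ F.eval P := Finset.le_sup (f := fun i => F.term i P) hi
  constructor
  · intro h j hj
    have h2 : F.term j P ≤ F.eval P := Finset.le_sup (f := fun i => F.term i P) hj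
    rw [← h, term_eq_realTerm hi, term_eq_realTerm hj] at h2
    exact_mod_cast h2
  · intro h
    refine le_antisymm h1 (Finset.sup_le fun j hj => ?_)
    rw [term_eq_realTerm hi, term_eq_realTerm hj]
    exact_mod_cast h j hj

lemma maxTerms_nonempty (hF : F.support.Nonempty) (P : ℝ × ℝ) : (F.maxTerms P).Nonempty := by
  obtain ⟨i, hi, h⟩ := F.support.exists_max_image (fun i => F.realTerm i P) hF
  exact ⟨i, mem_maxTerms.2 ⟨hi, h⟩⟩

lemma realTerm_eq {i j : ℤ × ℤ} (hi : i ∈ F.maxTerms P) (hj : j ∈ F.maxTerms P) :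
    F.realTerm i P = F.realTerm j P :=
  le_antisymm ((mem_maxTerms.1 hj).2 i (mem_maxTerms.1 hi).1)
    ((mem_maxTerms.1 hi).2 j (mem_maxTerms.1 hj).1)

lemma realTerm_lt {i j : ℤ × ℤ} (hi : i ∈ F.support) (hi' : i ∉ F.maxTerms P)
    (hj : j ∈ F.maxTerms P) : F.realTerm i P < F.realTerm j P := by
  refine lt_of_le_of_ne ((mem_maxTerms.1 hj).2 i hi) fun h => hi' (mem_maxTerms.2 ⟨hi, ?_⟩)
  rw [h]
  exact (mem_maxTerms.1 hj).2

lemma mem_hypersurface (hF : F.support.Nonempty) :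
    P ∈ F.hypersurface ↔ (F.maxTerms P).Nontrivial := by
  have hne : F.eval P ≠ ⊥ := by
    obtain ⟨i, hi⟩ := hF
    intro h
    have h2 : F.term i P ≤ F.eval P := Finset.le_sup (f := fun i => F.term i P) hi
    rw [h, term_eq_realTerm hi] at h2
    simp at h2
  have hs : ∀ i, F.term i P = F.eval P → i ∈ F.support := by
    intro i hi
    refine mem_support.2 fun h => hne ?_
    rw [← hi, term, h, WithBot.bot_add]
  constructor
  · rintro ⟨i, j, hij, hi, hj⟩
    exact ⟨i, by simp [maxTerms, hi, hs i hi], j, by simp [maxTerms, hj, hs j hj], hij⟩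
  · rintro ⟨i, hi, j, hj, hij⟩
    simp only [maxTerms, Finset.coe_filter, Set.mem_ofPred_eq] at hi hj
    exact ⟨i, j, hij, hi.2, hj.2⟩

lemma realTerm_add_smul (i : ℤ × ℤ) (P d : ℝ × ℝ) (t : ℝ) :
    F.realTerm i (P + t • d) = F.realTerm i P + t * dot i d := by
  simp only [realTerm, dot_add, dot_smul]; ring

/-- For small `t > 0` the terms that are not maximal at `P` stay below by continuity, and those tied
at `P` are separated by their slopes in the direction `d`. This reduces the local shape of the curve
to faces of `F.maxTerms P`. -/
lemma eventually_maxTerms_eq_face (hF : F.support.Nonempty) (P d : ℝ × ℝ) :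
    ∀ᶠ t in 𝓝[>] (0 : ℝ), F.maxTerms (P + t • d) = face (F.maxTerms P) d := by
  have key : ∀ᶠ t in 𝓝[>] (0 : ℝ), ∀ i ∈ F.support, i ∉ F.maxTerms P → ∀ j ∈ F.maxTerms P,
      F.realTerm i (P + t • d) < F.realTerm j (P + t • d) := by
    rw [Filter.eventually_all_finset]
    intro i hi
    by_cases hiM : i ∈ F.maxTerms P
    · exact Filter.Eventually.of_forall fun _ h => absurd hiM h
    simp only [hiM, not_false_eq_true, forall_const]
    rw [Filter.eventually_all_finset]
    intro j hj
    refine nhdsWithin_le_nhds ?_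
    simp only [realTerm_add_smul]
    have h := realTerm_lt hi hiM hj
    refine ContinuousAt.eventually_lt (by fun_prop) (by fun_prop) ?_
    simpa using h
  filter_upwards [key, self_mem_nhdsWithin] with t ht ht0
  rw [Set.mem_Ioi] at ht0
  obtain ⟨m, hm⟩ := maxTerms_nonempty hF P
  ext i
  rw [mem_face, mem_maxTerms]
  constructor
  · rintro ⟨hi, h⟩
    have hiM : i ∈ F.maxTerms P := by
      by_contra hn
      exact absurd (ht i hi hn m hm) (not_lt.2 (h m (mem_maxTerms.1 hm).1))
    refine ⟨hiM, fun j hj => ?_⟩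
    have := h j (mem_maxTerms.1 hj).1
    rw [realTerm_add_smul, realTerm_add_smul, realTerm_eq hiM hj] at this
    exact le_of_mul_le_mul_left (by linarith) ht0
  · rintro ⟨hiM, h⟩
    refine ⟨(mem_maxTerms.1 hiM).1, fun j hj => ?_⟩
    by_cases hjM : j ∈ F.maxTerms P
    · rw [realTerm_add_smul, realTerm_add_smul, realTerm_eq hiM hjM]
      have := mul_le_mul_of_nonneg_left (h j hjM) ht0.le
      linarith
    · exact (ht j hj hjM i hiM).le

lemma collinear_of_dot_eq (hd : d ≠ 0) (h : ∀ a ∈ A, ∀ b ∈ A, dot a d = dot b d) :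
    Collinear ℝ (toPlane '' (A : Set (ℤ × ℤ))) := by
  rcases A.eq_empty_or_nonempty with rfl | ⟨a, ha⟩
  · simp [collinear_empty]
  rw [collinear_iff_exists_forall_eq_smul_vadd]
  refine ⟨toPlane a, (-d.2, d.1), ?_⟩
  rintro _ ⟨b, hb, rfl⟩
  have hab := h b hb a ha
  obtain ⟨c, hc⟩ := exists_eq_smul_of_cross_eq_zero (d := (-d.2, d.1))
    (e := toPlane b - toPlane a) (by
      intro h0
      rw [Prod.mk_eq_zero] at h0
      exact hd (Prod.ext h0.2 (neg_eq_zero.1 h0.1))) (by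
      simp only [cross, toPlane, Prod.fst_sub, Prod.snd_sub]
      unfold dot at hab
      linarith)
  exact ⟨c, by rw [← hc]; simp⟩

/-- `A` is dual to an edge of `V(F)` that contains a segment from `P` in the direction `d`. -/
def EdgeGerm (F : TropPoly) (P d : ℝ × ℝ) (A : Finset (ℤ × ℤ)) : Prop :=
  A ∈ F.dualSegments ∧ ∀ᶠ t in 𝓝[≥] (0 : ℝ), P + t • d ∈ F.dualCell A

lemma EdgeGerm.mem_dualCell (h : EdgeGerm F P d A) : P ∈ F.dualCell A := by
  simpa using h.2.self_of_nhdsWithin (Set.self_mem_Ici)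

lemma nontrivial_of_mem_dualSegments (h : A ∈ F.dualSegments) : A.Nontrivial := by
  simp only [dualSegments, Finset.mem_filter] at h
  exact h.2.2.1

lemma dot_eq_of_mem_dualCell {Q : ℝ × ℝ} (hP : P ∈ F.dualCell A) (hQ : Q ∈ F.dualCell A) :
    ∀ a ∈ A, ∀ b ∈ A, dot a (Q - P) = dot b (Q - P) := by
  intro a ha b hb
  have h1 := realTerm_eq (hP ha) (hP hb)
  have h2 := realTerm_eq (hQ ha) (hQ hb)
  unfold realTerm at h1 h2
  rw [dot_sub, dot_sub]
  linarith

lemma EdgeGerm.dot_eq (h : EdgeGerm F P d A) : ∀ a ∈ A, ∀ b ∈ A, dot a d = dot b d := by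
  intro a ha b hb
  have h2 := h.2.filter_mono (nhdsWithin_mono _ Set.Ioi_subset_Ici_self)
  obtain ⟨t, ht, ht0⟩ := (h2.and self_mem_nhdsWithin).exists
  have := dot_eq_of_mem_dualCell h.mem_dualCell ht a ha b hb
  rw [add_sub_cancel_left, dot_smul, dot_smul] at this
  exact mul_left_cancel₀ (ne_of_gt ht0) this

lemma edgeGerm_face (hF : F.support.Nonempty) (hd : d ≠ 0)
    (h : (face (F.maxTerms P) d).Nontrivial) : EdgeGerm F P d (face (F.maxTerms P) d) := by
  have key := eventually_maxTerms_eq_face hF P d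
  constructor
  · obtain ⟨t, ht⟩ := key.exists
    simp only [dualSegments, Finset.mem_filter, Finset.mem_powerset]
    refine ⟨fun i hi => (mem_maxTerms.1 (mem_face.1 hi).1).1, ⟨_, ht.symm⟩, h,
      collinear_of_dot_eq hd fun a ha b hb => face_dot_eq ha hb⟩
  · rw [← Set.Ioi_insert, nhdsWithin_insert, Filter.eventually_sup]
    constructor
    · simp only [Filter.eventually_pure, zero_smul, add_zero]
      exact fun i hi => (mem_face.1 hi).1
    · filter_upwards [key] with t ht
      exact ht.symm.subset

lemma EdgeGerm.eventually_mem_hypersurface (hF : F.support.Nonempty) (h : EdgeGerm F P d A) :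
    ∀ᶠ t in 𝓝[≥] (0 : ℝ), P + t • d ∈ F.hypersurface := by
  filter_upwards [h.2] with t ht
  exact (mem_hypersurface hF).2 ((nontrivial_of_mem_dualSegments h.1).mono ht)

/-- If `V(F)` contains points arbitrarily close to `P` in the direction `d`, then it contains an edge
from `P` in this direction. -/
lemma face_nontrivial_of_frequently (hF : F.support.Nonempty)
    (h : ∃ᶠ t in 𝓝[>] (0 : ℝ), P + t • d ∈ F.hypersurface) :
    (face (F.maxTerms P) d).Nontrivial := by
  obtain ⟨t, h1, h2⟩ := (h.and_eventually (eventually_maxTerms_eq_face hF P d)).exists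
  rw [mem_hypersurface hF] at h1
  rwa [← h2]

end TropPoly

/-! ### Transverse multiplicities -/

section

variable {A B : Finset (ℤ × ℤ)} {d e : ℝ × ℝ}

/-- The choice in `edgeVector` is meaningful only once a witness exists: the difference of two
exponents, divided by its gcd and turned by a right angle. The vector `d` forces all other
differences to be parallel to this one. -/
lemma edgeVector_spec (hA : A.Nontrivial) (hd : d ≠ 0)
    (h : ∀ a ∈ A, ∀ b ∈ A, dot a d = dot b d) :
    Int.gcd (edgeVector A).1 (edgeVector A).2 = 1 ∧
      ∀ a ∈ A, ∀ b ∈ A, (edgeVector A).1 * (b.1 - a.1) + (edgeVector A).2 * (b.2 - a.2) = 0 := by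
  obtain ⟨a, ha, b, hb, hab⟩ := hA
  apply Classical.epsilon_spec (p := fun v : ℤ × ℤ => Int.gcd v.1 v.2 = 1 ∧
    ∀ a ∈ A, ∀ b ∈ A, v.1 * (b.1 - a.1) + v.2 * (b.2 - a.2) = 0)
  have hne : ¬ (b.1 - a.1 = 0 ∧ b.2 - a.2 = 0) := fun h0 =>
    hab (Prod.ext (sub_eq_zero.1 h0.1).symm (sub_eq_zero.1 h0.2).symm)
  have hg : 0 < Int.gcd (b.1 - a.1) (b.2 - a.2) := by
    rw [Nat.pos_iff_ne_zero, Ne, Int.gcd_eq_zero_iff]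
    exact hne
  obtain ⟨x, hx⟩ := Int.gcd_dvd_left (a := b.1 - a.1) (b := b.2 - a.2)
  obtain ⟨y, hy⟩ := Int.gcd_dvd_right (a := b.1 - a.1) (b := b.2 - a.2)
  set g := Int.gcd (b.1 - a.1) (b.2 - a.2) with hgd
  have hxy : Int.gcd x y = 1 := by
    have h1 : Int.gcd (g * x) (g * y) = g := by rw [← hx, ← hy]
    rw [Int.gcd_mul_left, Int.natAbs_natCast] at h1
    exact Nat.eq_of_mul_eq_mul_left hg (by rw [h1, mul_one])
  refine ⟨(-y, x), by simpa [Int.gcd_comm] using hxy, fun a' ha' b' hb' => ?_⟩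
  have h1 := h a ha b hb
  have h2 := h a' ha' b' hb'
  unfold dot at h1 h2
  have hbad : ((b.1 : ℝ) - a.1) = g * x := by exact_mod_cast hx
  have hbad2 : ((b.2 : ℝ) - a.2) = g * y := by exact_mod_cast hy
  have hg' : (0 : ℝ) < g := by exact_mod_cast hg
  have h3 : (x : ℝ) * d.1 + y * d.2 = 0 := by
    apply mul_left_cancel₀ hg'.ne'
    linear_combination -d.1 * hbad - d.2 * hbad2 - h1
  have h4 : ((b'.1 : ℝ) - a'.1) * d.1 + (b'.2 - a'.2) * d.2 = 0 := by linear_combination -h2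
  have h5 : (-y : ℝ) * (b'.1 - a'.1) + x * (b'.2 - a'.2) = 0 := by
    have e1 : d.1 * ((-y : ℝ) * (b'.1 - a'.1) + x * (b'.2 - a'.2)) = 0 := by
      linear_combination (b'.2 - a'.2 : ℝ) * h3 - y * h4
    have e2 : d.2 * ((-y : ℝ) * (b'.1 - a'.1) + x * (b'.2 - a'.2)) = 0 := by
      linear_combination (-(b'.1 - a'.1) : ℝ) * h3 + x * h4
    by_contra hn
    exact hd (Prod.ext ((mul_eq_zero.1 e1).resolve_right hn) ((mul_eq_zero.1 e2).resolve_right hn))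
  exact_mod_cast h5

lemma toPlane_ne_zero_of_gcd {w : ℤ × ℤ} (h : Int.gcd w.1 w.2 = 1) : toPlane w ≠ 0 := by
  intro h0
  simp only [toPlane, Prod.mk_eq_zero, Int.cast_eq_zero] at h0
  simp [h0.1, h0.2] at h

lemma dot_edgeVector (hA : A.Nontrivial) (hd : d ≠ 0)
    (h : ∀ a ∈ A, ∀ b ∈ A, dot a d = dot b d) :
    ∀ a ∈ A, ∀ b ∈ A, dot a (toPlane (edgeVector A)) = dot b (toPlane (edgeVector A)) := by
  intro a ha b hb
  have := (edgeVector_spec hA hd h).2 a ha b hb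
  have h2 : ((edgeVector A).1 : ℝ) * (b.1 - a.1) + (edgeVector A).2 * (b.2 - a.2) = 0 := by
    exact_mod_cast this
  simp only [dot, toPlane]
  linarith

lemma exists_edgeVector_eq_smul (hA : A.Nontrivial) (hd : d ≠ 0)
    (h : ∀ a ∈ A, ∀ b ∈ A, dot a d = dot b d) :
    ∃ c : ℝ, c ≠ 0 ∧ toPlane (edgeVector A) = c • d := by
  have h1 := dot_edgeVector hA hd h
  have h2 := toPlane_ne_zero_of_gcd (edgeVector_spec hA hd h).1
  obtain ⟨a, ha, b, hb, hab⟩ := hA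
  obtain ⟨c, hc⟩ := exists_eq_smul_of_cross_eq_zero hd
    (cross_eq_zero_of_dot_eq hab (h a ha b hb) (h1 a ha b hb))
  refine ⟨c, ?_, hc⟩
  rintro rfl
  exact h2 (by rw [hc, zero_smul])

lemma latticeLength_pos (hA : A.Nontrivial) : 0 < latticeLength A := by
  obtain ⟨a, ha, b, hb, hab⟩ := hA
  have h1 : 0 < Int.gcd (b.1 - a.1) (b.2 - a.2) := by
    rw [Nat.pos_iff_ne_zero, Ne, Int.gcd_eq_zero_iff]
    exact fun h0 => hab (Prod.ext (sub_eq_zero.1 h0.1).symm (sub_eq_zero.1 h0.2).symm)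
  refine h1.trans_le ?_
  refine (Finset.le_sup (f := fun b : ℤ × ℤ => Int.gcd (b.1 - a.1) (b.2 - a.2)) hb).trans ?_
  exact Finset.le_sup
    (f := fun a : ℤ × ℤ => A.sup fun b : ℤ × ℤ => Int.gcd (b.1 - a.1) (b.2 - a.2)) ha

lemma gcd_le_latticeLength {a b : ℤ × ℤ} (ha : a ∈ A) (hb : b ∈ A) :
    Int.gcd (b.1 - a.1) (b.2 - a.2) ≤ latticeLength A := by
  refine (Finset.le_sup (f := fun b : ℤ × ℤ => Int.gcd (b.1 - a.1) (b.2 - a.2)) hb).trans ?_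
  exact Finset.le_sup
    (f := fun a : ℤ × ℤ => A.sup fun b : ℤ × ℤ => Int.gcd (b.1 - a.1) (b.2 - a.2)) ha

lemma transverseMultiplicity_comm : transverseMultiplicity A B = transverseMultiplicity B A := by
  unfold transverseMultiplicity
  rw [mul_comm (latticeLength A), ← Int.natAbs_neg]
  congr 2
  ring

lemma cross_toPlane (a b : ℤ × ℤ) :
    cross (toPlane a) (toPlane b) = ((a.1 * b.2 - a.2 * b.1 : ℤ) : ℝ) := by
  simp [cross, toPlane]

lemma cross_smul_smul (a b : ℝ) : cross (a • d) (b • e) = a * b * cross d e := by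
  simp only [cross, Prod.smul_fst, Prod.smul_snd, smul_eq_mul]; ring

lemma transverseMultiplicity_pos (hA : A.Nontrivial) (hB : B.Nontrivial)
    (hAd : ∀ a ∈ A, ∀ b ∈ A, dot a d = dot b d) (hBe : ∀ a ∈ B, ∀ b ∈ B, dot a e = dot b e)
    (hde : cross d e ≠ 0) : 0 < transverseMultiplicity A B := by
  have hd : d ≠ 0 := by rintro rfl; simp [cross] at hde
  have he : e ≠ 0 := by rintro rfl; simp [cross] at hde
  obtain ⟨c, hc, hc'⟩ := exists_edgeVector_eq_smul hA hd hAd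
  obtain ⟨b, hb, hb'⟩ := exists_edgeVector_eq_smul hB he hBe
  refine Nat.mul_pos (Nat.mul_pos (latticeLength_pos hA) (latticeLength_pos hB)) ?_
  rw [Int.natAbs_pos]
  intro h0
  have := cross_toPlane (edgeVector A) (edgeVector B)
  rw [h0, hc', hb', cross_smul_smul, Int.cast_zero] at this
  exact mul_ne_zero (mul_ne_zero hc hb) hde this

lemma transverseMultiplicity_eq_zero (hA : A.Nontrivial) (hB : B.Nontrivial) (hd : d ≠ 0)
    (hAd : ∀ a ∈ A, ∀ b ∈ A, dot a d = dot b d) (hBd : ∀ a ∈ B, ∀ b ∈ B, dot a d = dot b d) :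
    transverseMultiplicity A B = 0 := by
  obtain ⟨c, hc, hc'⟩ := exists_edgeVector_eq_smul hA hd hAd
  obtain ⟨b, hb, hb'⟩ := exists_edgeVector_eq_smul hB hd hBd
  have := cross_toPlane (edgeVector A) (edgeVector B)
  rw [hc', hb', cross_smul_smul, show cross d d = 0 by unfold cross; ring, mul_zero] at this
  have h0 : (edgeVector A).1 * (edgeVector B).2 - (edgeVector A).2 * (edgeVector B).1 = 0 := by
    exact_mod_cast this.symm
  simp [transverseMultiplicity, h0]

end

/-! ### Generic displacements -/

lemma eventually_genericDisplacements {p : ℝ × ℝ → Prop} :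
    (∀ᶠ w in genericDisplacements, p w) ↔
      ∀ᶠ v in genericVectors, ∀ᶠ ε in 𝓝[≠] (0 : ℝ), p (ε • v) := by
  simp only [genericDisplacements, Filter.eventually_bind, Filter.eventually_map]

lemma eventually_genericVectors {a : ℝ × ℝ} (ha : a ≠ 0) :
    ∀ᶠ v in genericVectors, a.1 * v.1 + a.2 * v.2 ≠ 0 :=
  Filter.mem_iInf_of_mem a (Filter.mem_iInf_of_mem ha (Filter.mem_principal_self _))

/-- The excluded lines have measure zero. Hence a generic property cannot fail on a whole nonempty
open set of directions. -/
lemma ae_le_genericVectors :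
    MeasureTheory.ae (MeasureTheory.volume : MeasureTheory.Measure (ℝ × ℝ)) ≤ genericVectors := by
  refine le_iInf₂ fun a ha => ?_
  rw [Filter.le_principal_iff, MeasureTheory.mem_ae_iff]
  let φ : (ℝ × ℝ) →ₗ[ℝ] ℝ := a.1 • LinearMap.fst ℝ ℝ ℝ + a.2 • LinearMap.snd ℝ ℝ ℝ
  have hφ : {v : ℝ × ℝ | a.1 * v.1 + a.2 * v.2 ≠ 0}ᶜ = (LinearMap.ker φ : Set (ℝ × ℝ)) := by
    ext v; simp [φ]
  rw [hφ]
  refine MeasureTheory.Measure.addHaar_submodule _ _ fun h => ha ?_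
  rw [LinearMap.ker_eq_top] at h
  have h1 := LinearMap.congr_fun h (1, 0)
  have h2 := LinearMap.congr_fun h (0, 1)
  simp [φ] at h1 h2
  exact Prod.ext h1 h2

lemma frequently_genericDisplacements {O : Set (ℝ × ℝ)} (hO : IsOpen O) (hne : O.Nonempty)
    {p : ℝ × ℝ → Prop} (h : ∀ v ∈ O, ∀ᶠ ε in 𝓝[>] (0 : ℝ), p (ε • v)) :
    ∃ᶠ w in genericDisplacements, p w := by
  intro hn
  rw [eventually_genericDisplacements] at hn
  have h0 := ae_le_genericVectors hn
  have hpos := hO.measure_pos MeasureTheory.volume hne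
  obtain ⟨v, hvO, hv⟩ : ∃ v ∈ O, ∀ᶠ ε in 𝓝[≠] (0 : ℝ), ¬ p (ε • v) := by
    by_contra hc
    push Not at hc
    refine hpos.ne' (MeasureTheory.measure_mono_null (fun v hv => ?_)
      (MeasureTheory.mem_ae_iff.1 h0))
    simp only [Set.mem_compl_iff, Set.mem_ofPred_eq]
    exact hc v hv
  have h1 : ∀ᶠ ε in 𝓝[>] (0 : ℝ), ¬ p (ε • v) :=
    hv.filter_mono (nhdsWithin_mono _ fun _ h => ne_of_gt h)
  obtain ⟨ε, he, he'⟩ := (h1.and (h v hvO)).exists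
  exact he he'

/-- The punctured neighbourhoods of `0` contain both signs of `ε`; this is what makes the
intersection numbers symmetric in the two curves. -/
lemma eventually_genericDisplacements_neg {p : ℝ × ℝ → Prop}
    (h : ∀ᶠ w in genericDisplacements, p w) : ∀ᶠ w in genericDisplacements, p (-w) := by
  rw [eventually_genericDisplacements] at h ⊢
  filter_upwards [h] with v hv
  have ht : Filter.Tendsto (fun ε : ℝ => -ε) (𝓝[≠] 0) (𝓝[≠] 0) := by
    refine tendsto_nhdsWithin_iff.2 ⟨?_, ?_⟩
    · exact ((continuous_neg.tendsto' 0 0 neg_zero)).mono_left nhdsWithin_le_nhds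
    · filter_upwards [self_mem_nhdsWithin] with ε hε
      simpa using hε
  filter_upwards [ht.eventually hv] with ε hε
  rwa [← neg_smul]

lemma genericDisplacements_le_nhds : genericDisplacements ≤ 𝓝 0 := by
  intro U hU
  change ∀ᶠ w in genericDisplacements, w ∈ U
  rw [eventually_genericDisplacements]
  refine Filter.Eventually.of_forall fun v => nhdsWithin_le_nhds ?_
  have : Filter.Tendsto (fun ε : ℝ => ε • v) (𝓝 0) (𝓝 0) :=
    Continuous.tendsto' (by fun_prop) _ _ (zero_smul _ _)
  exact this hU

lemma limsup_genericDisplacements_neg (c : ℝ × ℝ → ℕ) :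
    Filter.limsup (fun w => c (-w)) genericDisplacements = Filter.limsup c genericDisplacements := by
  rw [Filter.limsup_eq, Filter.limsup_eq]
  congr 1
  ext a
  exact ⟨fun h => by simpa using eventually_genericDisplacements_neg h,
    fun h => eventually_genericDisplacements_neg (p := fun w => c w ≤ a) h⟩

namespace TropPoly

variable {F G : TropPoly} {P d e v n : ℝ × ℝ} {A B : Finset (ℤ × ℤ)}

/-! ### Symmetry -/

lemma ncard_vadd_inter (S T : Set (ℝ × ℝ)) (w : ℝ × ℝ) :
    ((w +ᵥ S) ∩ T).ncard = ((-w +ᵥ T) ∩ S).ncard := by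
  have : (-w +ᵥ T) ∩ S = (fun x => -w + x) '' ((w +ᵥ S) ∩ T) := by
    ext x
    simp only [Set.mem_inter_iff, Set.mem_image, Set.mem_vadd_set, vadd_eq_add]
    constructor
    · rintro ⟨⟨y, hy, rfl⟩, h⟩
      exact ⟨y, ⟨⟨_, h, by abel⟩, hy⟩, rfl⟩
    · rintro ⟨y, ⟨⟨z, hz, rfl⟩, h⟩, rfl⟩
      exact ⟨⟨_, h, rfl⟩, by simpa using hz⟩
  rw [this, Set.ncard_image_of_injective _ (add_right_injective _)]

lemma displacedCount_comm (w : ℝ × ℝ) : displacedCount F G P w = displacedCount G F P (-w) := by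
  unfold displacedCount
  rw [Finset.sum_comm]
  refine Finset.sum_congr rfl fun B _ => Finset.sum_congr rfl fun A _ => ?_
  rw [ncard_vadd_inter, transverseMultiplicity_comm]

lemma intersectionMultiplicity_comm :
    intersectionMultiplicity F G P = intersectionMultiplicity G F P := by
  unfold intersectionMultiplicity
  rw [← limsup_genericDisplacements_neg (fun w => displacedCount G F P w)]
  simp only [displacedCount_comm (F := F)]

/-- A point of `(V(F) - w) ∩ V(G)` translated by `w` lies in `(V(G) + w) ∩ V(F)`, and `w` is small
enough to stay in the neighbourhood. -/
lemma stableIntersection_subset : stableIntersection F G ⊆ stableIntersection G F := by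
  intro P hP U hU
  have hadd : Filter.Tendsto (fun x : (ℝ × ℝ) × (ℝ × ℝ) => x.1 + x.2) (𝓝 P ×ˢ 𝓝 0) (𝓝 P) := by
    simpa using (Filter.tendsto_fst (f := 𝓝 P) (g := 𝓝 (0 : ℝ × ℝ))).add Filter.tendsto_snd
  obtain ⟨U₁, hU₁, V, hV, h⟩ := Filter.mem_prod_iff.1 (hadd hU)
  filter_upwards [eventually_genericDisplacements_neg (hP U₁ hU₁),
    genericDisplacements_le_nhds hV] with w hw hwV
  obtain ⟨x, ⟨hxF, hxG⟩, hxU⟩ := hw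
  obtain ⟨y, hy, rfl⟩ := Set.mem_vadd_set.1 hxF
  refine ⟨y, ⟨Set.mem_vadd_set.2 ⟨_, hxG, by simp⟩, hy⟩, ?_⟩
  have := h (Set.mk_mem_prod hxU hwV)
  simpa using this

lemma multiplicityOn_comm (C : Set (ℝ × ℝ)) : F.multiplicityOn G C = G.multiplicityOn F C := by
  unfold multiplicityOn
  rw [subset_antisymm (stableIntersection_subset (F := F) (G := G)) stableIntersection_subset]
  simp only [intersectionMultiplicity_comm (F := F) (G := G)]

/-! ### Lower bounds for intersection multiplicities -/

/-- Two points in the intersection would span a direction common to both edges, and parallel edges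
have transverse multiplicity zero. -/
lemma subsingleton_vadd_inter (hA : A ∈ F.dualSegments) (hB : B ∈ G.dualSegments)
    (h : transverseMultiplicity A B ≠ 0) (w : ℝ × ℝ) :
    ((w +ᵥ F.dualCell A) ∩ G.dualCell B).Subsingleton := by
  rintro _ ⟨hx', hxB⟩ _ ⟨hy', hyB⟩
  obtain ⟨x, hx, rfl⟩ := Set.mem_vadd_set.1 hx'
  obtain ⟨y, hy, rfl⟩ := Set.mem_vadd_set.1 hy'
  by_contra hne
  refine h (transverseMultiplicity_eq_zero (nontrivial_of_mem_dualSegments hA)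
    (nontrivial_of_mem_dualSegments hB) (d := x - y) ?_ (dot_eq_of_mem_dualCell hy hx) ?_)
  · intro h0
    rw [sub_eq_zero.1 h0] at hne
    exact hne rfl
  · simpa using dot_eq_of_mem_dualCell hyB hxB

lemma ncard_mul_transverseMultiplicity_le (hA : A ∈ F.dualSegments) (hB : B ∈ G.dualSegments)
    (w : ℝ × ℝ) :
    ((w +ᵥ F.dualCell A) ∩ G.dualCell B).ncard * transverseMultiplicity A B ≤
      transverseMultiplicity A B := by
  by_cases h : transverseMultiplicity A B = 0
  · simp [h]
  · refine (Nat.mul_le_mul_right _ ?_).trans_eq (one_mul _)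
    have := (subsingleton_vadd_inter hA hB h w).finite.to_subtype
    rw [Set.ncard_le_one_iff_subsingleton]
    exact subsingleton_vadd_inter hA hB h w

lemma displacedCount_le (w : ℝ × ℝ) : displacedCount F G P w ≤
    ∑ A ∈ F.dualSegments, ∑ B ∈ G.dualSegments, transverseMultiplicity A B := by
  classical
  unfold displacedCount
  refine (Finset.sum_le_sum_of_subset (Finset.filter_subset _ _)).trans
    (Finset.sum_le_sum fun A hA => ?_)
  refine (Finset.sum_le_sum_of_subset (Finset.filter_subset _ _)).trans
    (Finset.sum_le_sum fun B hB => ?_)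
  exact ncard_mul_transverseMultiplicity_le hA hB w

lemma sum_le_displacedCount (T : Finset (Finset (ℤ × ℤ) × Finset (ℤ × ℤ))) {w : ℝ × ℝ}
    (h : ∀ q ∈ T, q.1 ∈ F.dualSegments ∧ q.2 ∈ G.dualSegments ∧ P ∈ F.dualCell q.1 ∧
      P ∈ G.dualCell q.2 ∧ transverseMultiplicity q.1 q.2 ≠ 0 ∧
      ((w +ᵥ F.dualCell q.1) ∩ G.dualCell q.2).Nonempty) :
    ∑ q ∈ T, transverseMultiplicity q.1 q.2 ≤ displacedCount F G P w := by
  classical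
  unfold displacedCount
  rw [← Finset.sum_product']
  refine le_trans (Finset.sum_le_sum fun q hq => ?_) (Finset.sum_le_sum_of_subset (s := T)
    fun q hq => ?_)
  · obtain ⟨hA, hB, -, -, hm, hne⟩ := h q hq
    refine Nat.le_mul_of_pos_left _ ?_
    rw [Set.ncard_pos (subsingleton_vadd_inter hA hB hm w).finite]
    exact hne
  · obtain ⟨hA, hB, hPA, hPB, -⟩ := h q hq
    simp [hA, hB, hPA, hPB]

lemma tendsto_mul_const_nhdsGE {t : ℝ} (ht : 0 ≤ t) :
    Filter.Tendsto (fun ε : ℝ => ε * t) (𝓝[>] 0) (𝓝[≥] 0) := by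
  refine tendsto_nhdsWithin_iff.2 ⟨?_, ?_⟩
  · exact (Continuous.tendsto' (continuous_mul_const t) _ _ (zero_mul _)).mono_left nhdsWithin_le_nhds
  · filter_upwards [self_mem_nhdsWithin] with ε hε
    exact mul_nonneg (le_of_lt hε) ht

/-- Edges are cones near `P`, so a crossing of the two half-lines for the displacement `w` scales
down to a crossing of the actual edges for `ε w`. -/
lemma EdgeGerm.eventually_mem_vadd_inter (hA : EdgeGerm F P d A) (hB : EdgeGerm G P e B)
    {w : ℝ × ℝ} {t t' : ℝ} (ht : 0 ≤ t) (ht' : 0 ≤ t') (h : w + t • d = t' • e) :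
    ∀ᶠ ε in 𝓝[>] (0 : ℝ),
      P + (ε * t') • e ∈ (ε • w +ᵥ F.dualCell A) ∩ G.dualCell B := by
  filter_upwards [(tendsto_mul_const_nhdsGE ht).eventually hA.2,
    (tendsto_mul_const_nhdsGE ht').eventually hB.2] with ε h1 h2
  refine ⟨Set.mem_vadd_set.2 ⟨_, h1, ?_⟩, h2⟩
  rw [vadd_eq_add, mul_smul, mul_smul, ← h, smul_add]
  abel

/-- Edges of `V(F)` and of `V(G)` at `P` that cross for all displacements in an open cone of
directions contribute to the intersection multiplicity. -/
lemma sum_le_intersectionMultiplicity (hvn : cross v n ≠ 0)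
    (T : Finset (Finset (ℤ × ℤ) × Finset (ℤ × ℤ))) {O : Set (ℝ × ℝ)} (hO : IsOpen O)
    (hne : O.Nonempty)
    (h : ∀ q ∈ T, ∃ d e, EdgeGerm F P d q.1 ∧ EdgeGerm G P e q.2 ∧ cross d e ≠ 0 ∧
      ∀ x ∈ O, ∃ t t' : ℝ, 0 ≤ t ∧ 0 ≤ t' ∧ x.1 • n + x.2 • v + t • d = t' • e) :
    ∑ q ∈ T, transverseMultiplicity q.1 q.2 ≤ intersectionMultiplicity F G P := by
  -- Coordinates in the basis `n, v` by Cramer's rule; `O` is a set of displacements in these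
  -- coordinates.
  let φ : ℝ × ℝ → ℝ × ℝ := fun w => (cross v w / cross v n, cross w n / cross v n)
  have hφ : Continuous φ := by unfold φ cross; fun_prop
  have hφw : ∀ w, w = (φ w).1 • n + (φ w).2 • v := by
    intro w
    unfold cross at hvn
    ext
    · simp only [φ, cross, Prod.fst_add, Prod.smul_fst, smul_eq_mul]; field_simp; ring
    · simp only [φ, cross, Prod.snd_add, Prod.smul_snd, smul_eq_mul]; field_simp; ring
  have hφc : ∀ x : ℝ × ℝ, φ (x.1 • n + x.2 • v) = x := by
    intro x
    refine Prod.ext ((div_eq_iff hvn).2 ?_) ((div_eq_iff hvn).2 ?_) <;>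
    · simp only [cross, Prod.fst_add, Prod.smul_fst, Prod.snd_add, Prod.smul_snd, smul_eq_mul]
      ring
  -- A limit superior in `ℕ` can be bounded below this way only for a bounded function, hence
  -- `displacedCount_le`.
  refine Filter.le_limsup_of_frequently_le ?_ ⟨_, Filter.eventually_map.2
    (Filter.Eventually.of_forall fun w => displacedCount_le w)⟩
  refine frequently_genericDisplacements (hO.preimage hφ) ?_ ?_
  · obtain ⟨x, hx⟩ := hne
    exact ⟨x.1 • n + x.2 • v, by rwa [Set.mem_preimage, hφc]⟩
  · intro w hw
    have key : ∀ᶠ ε in 𝓝[>] (0 : ℝ), ∀ q ∈ T,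
        ((ε • w +ᵥ F.dualCell q.1) ∩ G.dualCell q.2).Nonempty := by
      rw [Filter.eventually_all_finset]
      intro q hq
      obtain ⟨d, e, hd, he, -, hx⟩ := h q hq
      obtain ⟨t, t', ht, ht', hE⟩ := hx _ hw
      rw [← hφw] at hE
      filter_upwards [hd.eventually_mem_vadd_inter he ht ht' hE] with ε hε
      exact ⟨_, hε⟩
    filter_upwards [key] with ε hε
    refine sum_le_displacedCount T fun q hq => ?_
    obtain ⟨d, e, hd, he, hc, -⟩ := h q hq
    exact ⟨hd.1, he.1, hd.mem_dualCell, he.mem_dualCell,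
      (transverseMultiplicity_pos (nontrivial_of_mem_dualSegments hd.1)
        (nontrivial_of_mem_dualSegments he.1) hd.dot_eq he.dot_eq hc).ne', hε q hq⟩

/-- Displacements parallel to `v`, for which curves sharing an edge in this direction may still
overlap, are not generic, so `x ≠ 0` may be assumed. Negative `ε` reduces to positive `ε` by
reversing the displacement. -/
lemma mem_stableIntersection (hF : F.support.Nonempty) (hG : G.support.Nonempty)
    (hvn : cross v n ≠ 0)
    (h : ∀ x y : ℝ, x ≠ 0 → ∃ d e A B, EdgeGerm F P d A ∧ EdgeGerm G P e B ∧
      ∃ t t' : ℝ, 0 ≤ t ∧ 0 ≤ t' ∧ x • n + y • v + t • d = t' • e) :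
    P ∈ stableIntersection F G := by
  have key : ∀ x y : ℝ, x ≠ 0 → ∀ U ∈ 𝓝 P, ∀ᶠ ε in 𝓝[>] (0 : ℝ),
      (((ε • (x • n + y • v) +ᵥ F.hypersurface) ∩ G.hypersurface) ∩ U).Nonempty := by
    intro x y hx U hU
    obtain ⟨d, e, A, B, hA, hB, t, t', ht, ht', hE⟩ := h x y hx
    have hlim : Filter.Tendsto (fun ε : ℝ => P + (ε * t') • e) (𝓝[>] 0) (𝓝 P) :=
      (Continuous.tendsto' (by fun_prop) _ _ (by simp)).mono_left nhdsWithin_le_nhds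
    filter_upwards [hA.eventually_mem_vadd_inter hB ht ht' hE, hlim hU] with ε h1 h2
    refine ⟨_, ⟨?_, ?_⟩, h2⟩
    · exact Set.vadd_set_mono (fun Q hQ => (mem_hypersurface hF).2
        ((nontrivial_of_mem_dualSegments hA.1).mono hQ)) h1.1
    · exact (mem_hypersurface hG).2 ((nontrivial_of_mem_dualSegments hB.1).mono h1.2)
  intro U hU
  rw [eventually_genericDisplacements]
  have hv : ((-v.2, v.1) : ℝ × ℝ) ≠ 0 := by
    intro h0
    rw [Prod.mk_eq_zero] at h0
    apply hvn
    rw [cross, h0.2, neg_eq_zero.1 h0.1]; ring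
  filter_upwards [eventually_genericVectors hv] with w hw
  obtain ⟨x, y, rfl⟩ := exists_coords hvn w
  have hx : x ≠ 0 := by
    rintro rfl
    apply hw
    simp only [Prod.fst_add, Prod.smul_fst, Prod.snd_add, Prod.smul_snd, smul_eq_mul]
    ring
  rw [← nhdsLT_sup_nhdsGT, Filter.eventually_sup]
  refine ⟨?_, key x y hx U hU⟩
  have hneg : Filter.Tendsto (fun ε : ℝ => -ε) (𝓝[<] 0) (𝓝[>] 0) := by
    simpa using tendsto_neg_nhdsLT (a := (0 : ℝ))
  filter_upwards [hneg.eventually (key (-x) (-y) (neg_ne_zero.2 hx) U hU)] with ε hε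
  rwa [show -ε • (-x • n + -y • v) = ε • (x • n + y • v) by module] at hε

end TropPoly

/-! ### Vertices on a common ray -/

lemma cross_perp_ne_zero {v : ℝ × ℝ} (hv : v ≠ 0) : cross v (-v.2, v.1) ≠ 0 := by
  intro h
  apply hv
  simp only [cross] at h
  ext
  · simp only [Prod.fst_zero]; nlinarith [sq_nonneg v.1, sq_nonneg v.2]
  · simp only [Prod.snd_zero]; nlinarith [sq_nonneg v.1, sq_nonneg v.2]

lemma cross_neg_right (v n : ℝ × ℝ) : cross v (-n) = -cross v n := by
  simp only [cross, Prod.fst_neg, Prod.snd_neg]; ring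

lemma cross_comb (v n : ℝ × ℝ) (a b c d : ℝ) :
    cross (a • n + b • v) (c • n + d • v) = (b * c - a * d) * cross v n := by
  simp only [cross, Prod.fst_add, Prod.smul_fst, Prod.snd_add, Prod.smul_snd, smul_eq_mul]
  ring

namespace TropPoly

variable {F G : TropPoly} {P p d e v n : ℝ × ℝ} {A B : Finset (ℤ × ℤ)} {L : Set (ℝ × ℝ)}

/-- The exponents of the maximal terms at `P` do not all pair equally with `v`. If `V(F)` contains
an edge from `P` in the direction `v`, this means that `P` is a vertex of `V(F)`. -/
def IsVertex (F : TropPoly) (P v : ℝ × ℝ) : Prop :=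
  ∃ i ∈ F.maxTerms P, ∃ j ∈ F.maxTerms P, dot i v ≠ dot j v

lemma IsVertex.exists_edgeGerm (h : F.IsVertex P v) (hF : F.support.Nonempty)
    (hvn : cross v n ≠ 0) :
    ∃ s : ℝ, ∃ A, EdgeGerm F P (n + s • v) A ∧ ∃ i ∈ face (F.maxTerms P) v,
      ∃ j ∈ F.maxTerms P, dot j v < dot i v ∧ i ∈ A ∧ j ∈ A := by
  obtain ⟨s, i, hi, j, hj, hij, hi', hj'⟩ := exists_adjacent_face n h
  have hne : n + s • v ≠ 0 := by
    intro h0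
    have := cross_comb v n 0 1 1 s
    simp only [zero_smul, one_smul, zero_add, h0, one_mul, mul_one, zero_mul, sub_zero] at this
    apply hvn
    rw [← this]
    simp [cross]
  refine ⟨s, _, edgeGerm_face hF hne ⟨i, hi', j, hj', ?_⟩, i, hi, j, hj, hij, hi', hj'⟩
  rintro rfl
  exact lt_irrefl _ hij

lemma edgeGerm_of_not_isVertex (h : ¬ G.IsVertex P v) (hG : G.support.Nonempty) (hv : v ≠ 0)
    (hR : (face (G.maxTerms P) v).Nontrivial) :
    EdgeGerm G P v (G.maxTerms P) ∧ EdgeGerm G P (-v) (G.maxTerms P) := by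
  have h' : ∀ i ∈ G.maxTerms P, ∀ j ∈ G.maxTerms P, dot i v = dot j v := by
    unfold IsVertex at h
    push Not at h
    exact h
  have h1 : face (G.maxTerms P) v = G.maxTerms P := face_eq_self h'
  have h2 : face (G.maxTerms P) (-v) = G.maxTerms P :=
    face_eq_self fun i hi j hj => by rw [dot_neg, dot_neg, h' i hi j hj]
  rw [h1] at hR
  constructor
  · have := edgeGerm_face hG hv (by rwa [h1])
    rwa [h1] at this
  · have := edgeGerm_face hG (neg_ne_zero.2 hv) (by rwa [h2])
    rwa [h2] at this

/-- Crossings of the displaced curve with the other one, for displacements to the side of `n`. -/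
lemma exists_crossing (hF : F.support.Nonempty) (hG : G.support.Nonempty) (hvn : cross v n ≠ 0)
    (hv : v ≠ 0) (hRF : (face (F.maxTerms P) v).Nontrivial)
    (hRG : (face (G.maxTerms P) v).Nontrivial) (hV : F.IsVertex P v) {x : ℝ} (hx : 0 < x) (y : ℝ) :
    ∃ d e A B, EdgeGerm F P d A ∧ EdgeGerm G P e B ∧
      ∃ t t' : ℝ, 0 ≤ t ∧ 0 ≤ t' ∧ x • n + y • v + t • d = t' • e := by
  have hvn' : cross v (-n) ≠ 0 := by rw [cross_neg_right]; exact neg_ne_zero.2 hvn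
  obtain ⟨s, A, hA, -⟩ := hV.exists_edgeGerm hF hvn'
  have hB := edgeGerm_face hG hv hRG
  -- The displaced edge with direction `-n + s v` returns to the line through `P` at `(y + x s) v`.
  -- It meets the ray of `V(G)` if this coefficient is nonnegative.
  rcases le_or_gt 0 (y + x * s) with h0 | h0
  · exact ⟨_, _, _, _, hA, hB, x, y + x * s, hx.le, h0, by module⟩
  by_cases hVG : G.IsVertex P v
  · obtain ⟨s', B', hB', -⟩ := hVG.exists_edgeGerm hG hvn
    rcases le_or_gt y (x * s') with h1 | h1
    · exact ⟨_, _, _, _, edgeGerm_face hF hv hRF, hB', x * s' - y, x, by linarith, hx.le,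
        by module⟩
    -- Here `x s' < y < -x s`: the displaced ray of `V(F)` misses the edge `n + s' v` of `V(G)`, but
    -- the displaced edge `-n + s v` crosses it.
    · have hneg : 0 < -(s + s') := by
        by_contra hc
        have : 0 ≤ x * (s + s') := mul_nonneg hx.le (by linarith)
        nlinarith
      have ht : (y - x * s') / -(s + s') * -(s + s') = y - x * s' := div_mul_cancel₀ _ hneg.ne'
      refine ⟨_, _, _, _, hA, hB', (y - x * s') / -(s + s'), x - (y - x * s') / -(s + s'), ?_, ?_,
        ?_⟩
      · exact div_nonneg (by linarith) hneg.le
      · rw [sub_nonneg, div_le_iff₀ hneg]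
        linarith
      · generalize (y - x * s') / -(s + s') = t at ht
        linear_combination (norm := module) (-ht) • v
  · exact ⟨_, _, _, _, hA, (edgeGerm_of_not_isVertex hVG hG hv hRG).2, x, -(y + x * s), hx.le,
      by linarith, by module⟩

lemma IsVertex.mem_stableIntersection (hV : F.IsVertex P v) (hF : F.support.Nonempty)
    (hG : G.support.Nonempty) (hv : v ≠ 0) (hRF : (face (F.maxTerms P) v).Nontrivial)
    (hRG : (face (G.maxTerms P) v).Nontrivial) : P ∈ stableIntersection F G := by
  have hvn := cross_perp_ne_zero hv
  refine TropPoly.mem_stableIntersection hF hG hvn fun x y hx => ?_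
  rcases lt_or_gt_of_ne hx with h | h
  · have := exists_crossing hF hG (n := -(-v.2, v.1))
      (by rw [cross_neg_right]; exact neg_ne_zero.2 hvn) hv hRF hRG hV (neg_pos.2 h) y
    rwa [neg_smul_neg] at this
  · exact exists_crossing hF hG hvn hv hRF hRG hV h y

/-- Displacing `V(F)` to the side of `-n`, and far enough along `v`, makes its edge on the side of
`n` cross the ray of `V(G)`. -/
lemma transverseMultiplicity_le (hvn : cross v n ≠ 0) {s : ℝ}
    (hA : EdgeGerm F P (n + s • v) A) (hB : EdgeGerm G P v B) :
    transverseMultiplicity A B ≤ intersectionMultiplicity F G P := by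
  have := sum_le_intersectionMultiplicity (F := F) (G := G) (P := P) hvn {(A, B)}
    (O := {x : ℝ × ℝ | x.1 < 0 ∧ s * x.1 < x.2})
    (.and (isOpen_lt (by fun_prop) (by fun_prop)) (isOpen_lt (by fun_prop) (by fun_prop)))
    ⟨(-1, -s + 1), by constructor <;> simp⟩ (by
      intro q hq
      rw [Finset.mem_singleton] at hq
      subst hq
      refine ⟨_, _, hA, hB, ?_, ?_⟩
      · have := cross_comb v n 1 s 0 1
        simp only [one_smul, zero_smul, zero_add] at this
        rw [this]
        simpa using hvn
      · rintro x ⟨h1, h2⟩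
        exact ⟨-x.1, x.2 - s * x.1, by linarith, by linarith, by module⟩)
  simpa using this

/-- The displacements that work for either edge contain a common open cone, so both crossings are
counted at once. -/
lemma transverseMultiplicity_add_le (hvn : cross v n ≠ 0) {s s' : ℝ} {A' : Finset (ℤ × ℤ)}
    (hA : EdgeGerm F P (n + s • v) A) (hA' : EdgeGerm F P (n + s' • v) A')
    (hB : EdgeGerm G P v B) (hne : A ≠ A') :
    transverseMultiplicity A B + transverseMultiplicity A' B ≤ intersectionMultiplicity F G P := by
  classical
  have hc : ∀ r : ℝ, cross (n + r • v) v ≠ 0 := by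
    intro r
    have := cross_comb v n 1 r 0 1
    simp only [one_smul, zero_smul, zero_add] at this
    rw [this]
    simpa using hvn
  have := sum_le_intersectionMultiplicity (F := F) (G := G) (P := P) hvn {(A, B), (A', B)}
    (O := {x : ℝ × ℝ | x.1 < 0 ∧ s * x.1 < x.2 ∧ s' * x.1 < x.2})
    (.and (isOpen_lt (by fun_prop) (by fun_prop))
      (.and (isOpen_lt (by fun_prop) (by fun_prop)) (isOpen_lt (by fun_prop) (by fun_prop))))
    ⟨(-1, |s| + |s'| + 1), by
      refine ⟨by simp, ?_, ?_⟩
      · have := neg_abs_le s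
        have := abs_nonneg s'
        simp only; linarith
      · have := neg_abs_le s'
        have := abs_nonneg s
        simp only; linarith⟩ (by
      intro q hq
      rw [Finset.mem_insert, Finset.mem_singleton] at hq
      rcases hq with rfl | rfl
      · refine ⟨_, _, hA, hB, hc s, ?_⟩
        rintro x ⟨h1, h2, -⟩
        exact ⟨-x.1, x.2 - s * x.1, by linarith, by linarith, by module⟩
      · refine ⟨_, _, hA', hB, hc s', ?_⟩
        rintro x ⟨h1, -, h2⟩
        exact ⟨-x.1, x.2 - s' * x.1, by linarith, by linarith, by module⟩)
  rwa [Finset.sum_pair (by simpa using hne)] at this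

lemma EdgeGerm.ne_of_cross_ne_zero {A' : Finset (ℤ × ℤ)} (hA : EdgeGerm F P d A)
    (hA' : EdgeGerm F P e A') (h : cross d e ≠ 0) : A ≠ A' := by
  rintro rfl
  obtain ⟨a, ha, b, hb, hab⟩ := nontrivial_of_mem_dualSegments hA.1
  exact h (cross_eq_zero_of_dot_eq hab (hA.dot_eq a ha b hb) (hA'.dot_eq a ha b hb))

lemma EdgeGerm.transverseMultiplicity_pos (hA : EdgeGerm F P d A) (hB : EdgeGerm G P e B)
    (h : cross d e ≠ 0) : 0 < transverseMultiplicity A B :=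
  TropicalCurve.transverseMultiplicity_pos (nontrivial_of_mem_dualSegments hA.1)
    (nontrivial_of_mem_dualSegments hB.1) hA.dot_eq hB.dot_eq h

/-- Two vertices with only one common edge direction intersect with multiplicity at least `2`. -/
lemma two_le_intersectionMultiplicity (hF : F.support.Nonempty) (hG : G.support.Nonempty)
    (hv : v ≠ 0) (hRF : (face (F.maxTerms P) v).Nontrivial)
    (hRG : (face (G.maxTerms P) v).Nontrivial) (hVF : F.IsVertex P v) (hVG : G.IsVertex P v)
    (hc : ∀ d A B, EdgeGerm F P d A → EdgeGerm G P d B → cross v d = 0) :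
    2 ≤ intersectionMultiplicity F G P := by
  classical
  obtain ⟨n, hvn⟩ : ∃ n, cross v n ≠ 0 := ⟨_, cross_perp_ne_zero hv⟩
  have hcr : ∀ a b c d : ℝ, b * c - a * d ≠ 0 → cross (a • n + b • v) (c • n + d • v) ≠ 0 :=
    fun a b c d h => by rw [cross_comb]; exact mul_ne_zero h hvn
  obtain ⟨s, A₁, hA₁, -⟩ := hVF.exists_edgeGerm hF hvn
  obtain ⟨r, A₂, hA₂, -⟩ := hVF.exists_edgeGerm (n := -n) hF (by
    rw [cross_neg_right]; exact neg_ne_zero.2 hvn)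
  obtain ⟨s', B₁, hB₁, -⟩ := hVG.exists_edgeGerm hG hvn
  have hA₀ := edgeGerm_face hF hv hRF
  have hB₀ := edgeGerm_face hG hv hRG
  set A₀ := face (F.maxTerms P) v
  set B₀ := face (G.maxTerms P) v
  have hvd : ∀ r : ℝ, cross v (n + r • v) ≠ 0 := fun r => by
    simpa using hcr 0 1 1 r (by simp)
  have hdv : ∀ r : ℝ, cross (-n + r • v) v ≠ 0 := fun r => by
    simpa using hcr (-1) r 0 1 (by simp)
  have hss : s ≠ s' := by
    rintro rfl
    exact hvd s (hc _ _ _ hA₁ hB₁)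
  have hAB : cross (n + s • v) (n + s' • v) ≠ 0 := by
    simpa using hcr 1 s 1 s' (by simpa [sub_eq_zero] using hss)
  -- Each order of the slopes admits an open cone of displacements with two crossings. If `s < s'`,
  -- move to the side of `n` and far along `v`: `A₁` crosses `B₁`, and `A₂` comes back to the ray
  -- `B₀`. If `s' < s`, move to the side of `n` but behind `B₁`: both `A₀` and `A₁` cross `B₁`.
  rcases lt_or_gt_of_ne hss with hlt | hgt
  · have := sum_le_intersectionMultiplicity (F := F) (G := G) (P := P) hvn {(A₁, B₁), (A₂, B₀)}
      (O := {x : ℝ × ℝ | 0 < x.1 ∧ s' * x.1 < x.2 ∧ -r * x.1 < x.2})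
      (.and (isOpen_lt (by fun_prop) (by fun_prop))
        (.and (isOpen_lt (by fun_prop) (by fun_prop)) (isOpen_lt (by fun_prop) (by fun_prop))))
      ⟨(1, |s'| + |r| + 1), by
        refine ⟨by simp, ?_, ?_⟩
        · have := le_abs_self s'
          have := abs_nonneg r
          simp only; linarith
        · have := neg_abs_le r
          have := abs_nonneg s'
          simp only; linarith⟩ (by
        intro q hq
        rw [Finset.mem_insert, Finset.mem_singleton] at hq
        rcases hq with rfl | rfl
        · refine ⟨_, _, hA₁, hB₁, hAB, ?_⟩
          rintro x ⟨h1, h2, -⟩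
          have hpos : 0 < s' - s := by linarith
          have ht : (x.2 - s' * x.1) / (s' - s) * (s' - s) = x.2 - s' * x.1 := by field_simp
          have ht0 : 0 ≤ (x.2 - s' * x.1) / (s' - s) := div_nonneg (by linarith) hpos.le
          generalize (x.2 - s' * x.1) / (s' - s) = t at ht ht0
          refine ⟨t, x.1 + t, ht0, by linarith, ?_⟩
          linear_combination (norm := module) (-ht) • v
        · refine ⟨_, _, hA₂, hB₀, hdv r, ?_⟩
          rintro x ⟨h1, -, h2⟩
          exact ⟨x.1, x.2 + r * x.1, by linarith, by linarith, by module⟩)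
    have hne : B₁ ≠ B₀ := (hB₀.ne_of_cross_ne_zero hB₁ (hvd s')).symm
    rw [Finset.sum_pair (by simp [hne])] at this
    have h1 := hA₁.transverseMultiplicity_pos hB₁ hAB
    have h2 := hA₂.transverseMultiplicity_pos hB₀ (hdv r)
    simp only at this
    omega
  · have := sum_le_intersectionMultiplicity (F := F) (G := G) (P := P) hvn {(A₀, B₁), (A₁, B₁)}
      (O := {x : ℝ × ℝ | 0 < x.1 ∧ x.2 < s' * x.1})
      (.and (isOpen_lt (by fun_prop) (by fun_prop)) (isOpen_lt (by fun_prop) (by fun_prop)))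
      ⟨(1, s' - 1), by constructor <;> simp⟩ (by
        intro q hq
        rw [Finset.mem_insert, Finset.mem_singleton] at hq
        rcases hq with rfl | rfl
        · refine ⟨_, _, hA₀, hB₁, hvd s', ?_⟩
          rintro x ⟨h1, h2⟩
          exact ⟨s' * x.1 - x.2, x.1, by linarith, by linarith, by module⟩
        · refine ⟨_, _, hA₁, hB₁, hAB, ?_⟩
          rintro x ⟨h1, h2⟩
          have hpos : 0 < s - s' := by linarith
          have ht : (s' * x.1 - x.2) / (s - s') * (s - s') = s' * x.1 - x.2 := by field_simp
          have ht0 : 0 ≤ (s' * x.1 - x.2) / (s - s') := div_nonneg (by linarith) hpos.le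
          generalize (s' * x.1 - x.2) / (s - s') = t at ht ht0
          refine ⟨t, x.1 + t, ht0, by linarith, ?_⟩
          linear_combination (norm := module) ht • v)
    have hne : A₀ ≠ A₁ := hA₀.ne_of_cross_ne_zero hA₁ (hvd s)
    rw [Finset.sum_pair (by simp [hne])] at this
    have h1 := hA₀.transverseMultiplicity_pos hB₁ (hvd s')
    have h2 := hA₁.transverseMultiplicity_pos hB₁ hAB
    simp only at this
    omega

lemma IsVertex.one_le_intersectionMultiplicity (hV : F.IsVertex P v) (hF : F.support.Nonempty)
    (hG : G.support.Nonempty) (hv : v ≠ 0) (hRG : (face (G.maxTerms P) v).Nontrivial) :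
    1 ≤ intersectionMultiplicity F G P := by
  have hvn := cross_perp_ne_zero hv
  obtain ⟨s, A, hA, -⟩ := hV.exists_edgeGerm hF hvn
  have hB := edgeGerm_face hG hv hRG
  refine le_trans (hA.transverseMultiplicity_pos hB ?_) (transverseMultiplicity_le hvn hA hB)
  have := cross_comb v (-v.2, v.1) 1 s 0 1
  simp only [one_smul, zero_smul, zero_add] at this
  rw [this]
  simpa using hvn

/-! ### Components of multiplicity one -/

/-- If all coefficients are `-∞`, the curve is the whole plane but has no edges. Multiplicity one
therefore rules out this degenerate case. -/
lemma intersectionMultiplicity_eq_zero_of_support (h : ¬ F.support.Nonempty) :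
    intersectionMultiplicity F G P = 0 := by
  classical
  have hd : ∀ w, displacedCount F G P w = 0 := by
    intro w
    unfold displacedCount
    refine Finset.sum_eq_zero fun A hA => ?_
    obtain ⟨a, ha, -⟩ := nontrivial_of_mem_dualSegments (Finset.mem_filter.1 hA).1
    have h2 := (Finset.mem_filter.1 hA).1
    simp only [dualSegments, Finset.mem_filter, Finset.mem_powerset] at h2
    exact absurd ⟨a, h2.1 ha⟩ h
  simp [intersectionMultiplicity, hd, Filter.limsup_eq]

lemma support_nonempty_of_multiplicityOn (h : F.multiplicityOn G L = 1) : F.support.Nonempty := by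
  by_contra hn
  simp [multiplicityOn, intersectionMultiplicity_eq_zero_of_support hn] at h

/-- A `finsum` with infinite support takes the default value `0`, so the value `1` certifies
finiteness. -/
lemma finite_of_multiplicityOn (h : F.multiplicityOn G L = 1) :
    ((stableIntersection F G ∩ L) ∩
      Function.support fun P => intersectionMultiplicity F G P).Finite := by
  by_contra hn
  rw [multiplicityOn, finsum_mem_eq_zero_of_infinite hn] at h
  exact zero_ne_one h

lemma sum_le_of_multiplicityOn (h : F.multiplicityOn G L = 1) (T : Finset (ℝ × ℝ))
    (hT : ∀ P ∈ T, P ∈ stableIntersection F G ∩ L) :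
    ∑ P ∈ T, intersectionMultiplicity F G P ≤ 1 := by
  have hfin := finite_of_multiplicityOn h
  rw [← h, multiplicityOn, finsum_mem_eq_sum _ hfin]
  refine Finset.sum_le_sum_of_ne_zero fun P hP h0 => ?_
  rw [Set.Finite.mem_toFinset]
  exact ⟨hT P hP, h0⟩

lemma raysOne_comm (h : L ∈ raysOne F G) : L ∈ raysOne G F := by
  obtain ⟨h1, h2, h3⟩ := h
  rw [Set.inter_comm] at h2
  exact ⟨h1, h2, by rwa [multiplicityOn_comm]⟩

lemma raysOne_subset (h : L ∈ raysOne F G) : L ⊆ F.hypersurface ∩ G.hypersurface := by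
  obtain ⟨-, ⟨x, -, rfl⟩, -⟩ := h
  exact connectedComponentIn_subset _ _

/-- Common edges from a point of the component stay in the component. -/
lemma exists_mem_of_edgeGerm (h : L ∈ raysOne F G) (hP : P ∈ L) (hA : EdgeGerm F P d A)
    (hB : EdgeGerm G P d B) : ∃ t : ℝ, 0 < t ∧ P + t • d ∈ L := by
  have hF := support_nonempty_of_multiplicityOn h.2.2
  have hG := support_nonempty_of_multiplicityOn (raysOne_comm h).2.2
  have hsub := raysOne_subset h
  obtain ⟨-, ⟨x, hx, rfl⟩, -⟩ := h
  have h1 := (hA.eventually_mem_hypersurface hF).and (hB.eventually_mem_hypersurface hG)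
  obtain ⟨δ, hδ, hδ'⟩ := mem_nhdsGE_iff_exists_Icc_subset.1 h1
  refine ⟨δ, hδ, ?_⟩
  rw [connectedComponentIn_eq hP]
  have hpre : IsPreconnected ((fun t : ℝ => P + t • d) '' Set.Icc 0 δ) :=
    isPreconnected_Icc.image _ (by fun_prop)
  refine hpre.subset_connectedComponentIn ⟨0, ⟨le_rfl, le_of_lt hδ⟩, by simp⟩ ?_
    ⟨δ, ⟨le_of_lt hδ, le_rfl⟩, rfl⟩
  rintro _ ⟨t, ht, rfl⟩
  exact hδ' ht

lemma face_nontrivial_of_mem_raysOne (hL : L ∈ raysOne F G)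
    (hLp : L = {x | ∃ t : ℝ, 0 ≤ t ∧ x = p + t • v})
    {t : ℝ} (ht : 0 ≤ t) :
    (face (F.maxTerms (p + t • v)) v).Nontrivial := by
  refine face_nontrivial_of_frequently (support_nonempty_of_multiplicityOn hL.2.2) ?_
  refine Filter.Eventually.frequently ?_
  filter_upwards [self_mem_nhdsWithin] with r hr
  refine (raysOne_subset hL ?_).1
  rw [hLp]
  exact ⟨t + r, add_nonneg ht (le_of_lt hr), by module⟩

lemma IsVertex.of_mem_raysOne (hL : L ∈ raysOne F G) (hv : v ≠ 0)
    (hLp : L = {x | ∃ t : ℝ, 0 ≤ t ∧ x = p + t • v})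
    {t : ℝ} (ht : 0 ≤ t) (hV : F.IsVertex (p + t • v) v) :
    p + t • v ∈ stableIntersection F G ∩ L ∧ 1 ≤ intersectionMultiplicity F G (p + t • v) := by
  have hF := support_nonempty_of_multiplicityOn hL.2.2
  have hG := support_nonempty_of_multiplicityOn (raysOne_comm hL).2.2
  have hRF := face_nontrivial_of_mem_raysOne hL hLp ht
  have hRG := face_nontrivial_of_mem_raysOne (raysOne_comm hL) hLp ht
  refine ⟨⟨hV.mem_stableIntersection hF hG hv hRF hRG, ?_⟩,
    hV.one_le_intersectionMultiplicity hF hG hv hRG⟩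
  rw [hLp]
  exact ⟨t, ht, rfl⟩

lemma IsVertex.of_mem_raysOne' (hL : L ∈ raysOne F G) (hv : v ≠ 0)
    (hLp : L = {x | ∃ t : ℝ, 0 ≤ t ∧ x = p + t • v})
    {t : ℝ} (ht : 0 ≤ t)
    (hV : F.IsVertex (p + t • v) v ∨ G.IsVertex (p + t • v) v) :
    p + t • v ∈ stableIntersection F G ∩ L ∧ 1 ≤ intersectionMultiplicity F G (p + t • v) := by
  rcases hV with hV | hV
  · exact hV.of_mem_raysOne hL hv hLp ht
  · obtain ⟨⟨h1, h2⟩, h3⟩ := hV.of_mem_raysOne (raysOne_comm hL) hv hLp ht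
    rw [intersectionMultiplicity_comm] at h3
    exact ⟨⟨stableIntersection_subset h1, h2⟩, h3⟩

/-- A common edge at `p` stays in the component, and from its endpoint `p` a ray can be followed
only in its own direction. -/
lemma eq_smul_of_edgeGerm (hL : L ∈ raysOne F G)
    (hLp : L = {x | ∃ t : ℝ, 0 ≤ t ∧ x = p + t • v})
    (hA : EdgeGerm F p d A) (hB : EdgeGerm G p d B) :
    ∃ c : ℝ, 0 ≤ c ∧ d = c • v := by
  have hp : p ∈ L := by rw [hLp]; exact ⟨0, le_rfl, by simp⟩
  obtain ⟨t, ht, h⟩ := exists_mem_of_edgeGerm hL hp hA hB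
  rw [hLp] at h
  obtain ⟨r, hr, h⟩ := h
  refine ⟨t⁻¹ * r, by positivity, ?_⟩
  rw [mul_smul, ← add_left_cancel h, inv_smul_smul₀ ht.ne']

lemma isVertex_or_isVertex (hL : L ∈ raysOne F G) (hv : v ≠ 0)
    (hLp : L = {x | ∃ t : ℝ, 0 ≤ t ∧ x = p + t • v}) : F.IsVertex p v ∨ G.IsVertex p v := by
  by_contra hn
  push Not at hn
  have hF := support_nonempty_of_multiplicityOn hL.2.2
  have hG := support_nonempty_of_multiplicityOn (raysOne_comm hL).2.2
  have hRF := face_nontrivial_of_mem_raysOne hL hLp le_rfl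
  have hRG := face_nontrivial_of_mem_raysOne (raysOne_comm hL) hLp le_rfl
  rw [zero_smul, add_zero] at hRF hRG
  obtain ⟨c, hc, h⟩ := eq_smul_of_edgeGerm hL hLp (edgeGerm_of_not_isVertex hn.1 hF hv hRF).2
    (edgeGerm_of_not_isVertex hn.2 hG hv hRG).2
  have : (c + 1) • v = 0 := by linear_combination (norm := module) -h
  rcases smul_eq_zero.1 this with h | h
  · linarith
  · exact hv h

/-- The endpoint `p` already accounts for multiplicity one, so a vertex at a second point would make
the total at least two. -/
lemma not_isVertex_of_pos (hL : L ∈ raysOne F G) (hv : v ≠ 0)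
    (hLp : L = {x | ∃ t : ℝ, 0 ≤ t ∧ x = p + t • v})
    {t : ℝ} (ht : 0 < t) : ¬ F.IsVertex (p + t • v) v := by
  classical
  intro hV
  have h1 := hV.of_mem_raysOne hL hv hLp ht.le
  have h2 := IsVertex.of_mem_raysOne' hL hv hLp le_rfl (t := 0)
    (by simpa using isVertex_or_isVertex hL hv hLp)
  have h3 := sum_le_of_multiplicityOn hL.2.2 {p + t • v, p + (0 : ℝ) • v} (by
    intro P hP
    rw [Finset.mem_insert, Finset.mem_singleton] at hP
    rcases hP with rfl | rfl
    exacts [h1.1, h2.1])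
  rw [Finset.sum_pair] at h3
  · omega
  · intro h
    rcases smul_eq_zero.1 (show t • v = 0 by simpa using h) with h | h
    · exact ht.ne' h
    · exact hv h

/-- A term growing faster along the ray would eventually overtake the maximal ones, and the first
time `t` at which this happens would give a vertex at `p + t v`. Consequently only nonnegative
powers of `u` occur later on. -/
lemma dot_le_of_mem_support (hL : L ∈ raysOne F G) (hv : v ≠ 0)
    (hLp : L = {x | ∃ t : ℝ, 0 ≤ t ∧ x = p + t • v})
    {i j : ℤ × ℤ} (hi : i ∈ face (F.maxTerms p) v) (hj : j ∈ F.support) :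
    dot j v ≤ dot i v := by
  classical
  by_contra hn
  push Not at hn
  obtain ⟨hiM, him⟩ := mem_face.1 hi
  obtain ⟨k, hk, hkm⟩ := (F.support.filter fun k => dot i v < dot k v).exists_min_image
    (fun k => (F.realTerm i p - F.realTerm k p) / (dot k v - dot i v))
    ⟨j, Finset.mem_filter.2 ⟨hj, hn⟩⟩
  obtain ⟨hks, hkv⟩ := Finset.mem_filter.1 hk
  set t := (F.realTerm i p - F.realTerm k p) / (dot k v - dot i v) with ht
  have hkv' : 0 < dot k v - dot i v := by linarith
  have hlt : F.realTerm k p < F.realTerm i p :=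
    realTerm_lt hks (fun h => absurd (him k h) (not_le.2 hkv)) hiM
  have ht0 : 0 < t := div_pos (by linarith) hkv'
  have hteq : t * (dot k v - dot i v) = F.realTerm i p - F.realTerm k p := by rw [ht]; field_simp
  have hmax : ∀ l ∈ F.support, F.realTerm l (p + t • v) ≤ F.realTerm i (p + t • v) := by
    intro l hl
    rw [realTerm_add_smul, realTerm_add_smul]
    rcases le_or_gt (dot l v) (dot i v) with h | h
    · have h1 := (mem_maxTerms.1 hiM).2 l hl
      have h2 := mul_le_mul_of_nonneg_left h ht0.le
      linarith
    · have h1 := hkm l (Finset.mem_filter.2 ⟨hl, h⟩)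
      rw [le_div_iff₀ (by linarith)] at h1
      linarith
  refine not_isVertex_of_pos hL hv hLp ht0 ⟨i, mem_maxTerms.2 ⟨(mem_maxTerms.1 hiM).1, hmax⟩,
    k, mem_maxTerms.2 ⟨hks, fun l hl => (hmax l hl).trans ?_⟩, hkv.ne⟩
  rw [realTerm_add_smul, realTerm_add_smul]
  linarith

end TropPoly

/-! ### The local model along the ray -/

/-- The integral pairing of two lattice vectors. -/
def height (ω i : ℤ × ℤ) : ℤ := ω.1 * i.1 + ω.2 * i.2

lemma dot_toPlane (i ω : ℤ × ℤ) : dot i (toPlane ω) = height ω i := by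
  simp only [dot, toPlane, height]; push_cast; ring

lemma height_lt_iff {ω i j : ℤ × ℤ} {v : ℝ × ℝ} {c : ℝ} (hc : 0 < c) (h : toPlane ω = c • v) :
    height ω i < height ω j ↔ dot i v < dot j v := by
  rw [← Int.cast_lt (R := ℝ), ← dot_toPlane, ← dot_toPlane, h, dot_smul, dot_smul,
    mul_lt_mul_iff_right₀ hc]

/-- The lattice vectors orthogonal to a primitive vector. -/
lemma exists_eq_mul_of_gcd_eq_one {x y a b : ℤ} (h : Int.gcd x y = 1) (h0 : x * a + y * b = 0) :
    ∃ k : ℤ, a = -(k * y) ∧ b = k * x := by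
  obtain ⟨s, t, hst⟩ := Int.isCoprime_iff_gcd_eq_one.2 h
  exact ⟨s * b - t * a, by linear_combination (-a) * hst + s * h0,
    by linear_combination (-b) * hst + t * h0⟩

/-- Two points of a segment of lattice length one. -/
lemma exists_coeff_of_latticeLength {A : Finset (ℤ × ℤ)} {ω a b : ℤ × ℤ}
    (hω : Int.gcd ω.1 ω.2 = 1)
    (h : ω.1 * (b.1 - a.1) + ω.2 * (b.2 - a.2) = 0) (hA : latticeLength A = 1)
    (ha : a ∈ A) (hb : b ∈ A) :
    ∃ k : ℤ, (k = 0 ∨ k = 1 ∨ k = -1) ∧ b.1 - a.1 = -(k * ω.2) ∧ b.2 - a.2 = k * ω.1 := by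
  obtain ⟨k, h1, h2⟩ := exists_eq_mul_of_gcd_eq_one hω h
  refine ⟨k, ?_, h1, h2⟩
  have := gcd_le_latticeLength ha hb
  rw [hA, h1, h2, Int.gcd_comm, Int.gcd_neg, Int.gcd_mul_left, hω, mul_one] at this
  omega

namespace TropPoly

variable {F G : TropPoly} {p v : ℝ × ℝ} {L : Set (ℝ × ℝ)}

/-- The shape of the dual subdivisions along the ray `p + ℝ≥0 v`: near the ray, `V(G)` is an edge of
multiplicity one, and `V(F)` has one vertex `p`, dual to a polygon of width one in the direction of
the ray whose face opposite to the ray is a point. -/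
structure LocalModel (F G : TropPoly) (p v : ℝ × ℝ) (ω b₀ b₁ i₀ k₀ : ℤ × ℤ) : Prop where
  primitive : Int.gcd ω.1 ω.2 = 1
  parallel : ∃ c : ℝ, 0 < c ∧ toPlane ω = c • v
  mem_b₀ : b₀ ∈ G.maxTerms p
  mem_b₁ : b₁ ∈ G.maxTerms p
  b₁_fst : b₁.1 = b₀.1 - ω.2
  b₁_snd : b₁.2 = b₀.2 + ω.1
  eq_or_eq : ∀ b ∈ G.maxTerms p, b = b₀ ∨ b = b₁
  mem_i₀ : i₀ ∈ F.maxTerms p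
  mem_k₀ : k₀ ∈ F.maxTerms p
  height_k₀ : height ω k₀ + 1 = height ω i₀
  eq_or_height_eq : ∀ i ∈ F.maxTerms p, i = k₀ ∨ height ω i = height ω i₀
  height_le : ∀ i ∈ F.support, height ω i ≤ height ω i₀
  height_le' : ∀ i ∈ G.support, height ω i ≤ height ω b₀

lemma neg_ne_smul {c : ℝ} (hv : v ≠ 0) (hc : 0 ≤ c) : -v ≠ c • v := by
  intro h
  have : (c + 1) • v = 0 := by linear_combination (norm := module) -h
  rcases smul_eq_zero.1 this with h | h
  · linarith
  · exact hv h

lemma exists_localModel (hL : L ∈ raysOne F G) (hv : v ≠ 0)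
    (hLp : L = {x | ∃ t : ℝ, 0 ≤ t ∧ x = p + t • v}) (hV : F.IsVertex p v) :
    ∃ ω b₀ b₁ i₀ k₀, LocalModel F G p v ω b₀ b₁ i₀ k₀ := by
  have hL' := raysOne_comm hL
  have hF := support_nonempty_of_multiplicityOn hL.2.2
  have hG := support_nonempty_of_multiplicityOn hL'.2.2
  have hRF := face_nontrivial_of_mem_raysOne hL hLp le_rfl
  have hRG := face_nontrivial_of_mem_raysOne hL' hLp le_rfl
  have hst := hV
  rw [show p = p + (0 : ℝ) • v by simp] at hst
  replace hst := (hst.of_mem_raysOne hL hv hLp le_rfl).1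
  rw [zero_smul, add_zero] at hRF hRG hst
  have hone : intersectionMultiplicity F G p ≤ 1 := by
    simpa using sum_le_of_multiplicityOn hL.2.2 {p} (by simpa using hst)
  have hGV : ¬ G.IsVertex p v := fun hGV => by
    have := two_le_intersectionMultiplicity hF hG hv hRF hRG hV hGV fun d A B hA hB => by
      obtain ⟨c, -, rfl⟩ := eq_smul_of_edgeGerm hL hLp hA hB
      simp only [cross, Prod.smul_fst, Prod.smul_snd, smul_eq_mul]; ring
    omega
  obtain ⟨hB, hB'⟩ := edgeGerm_of_not_isVertex hGV hG hv hRG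
  -- `V(G)` goes straight through `p`, so an edge of `V(F)` in the direction `-v` would be common to
  -- both curves and extend `L` beyond `p`.
  have hleft : ¬ (face (F.maxTerms p) (-v)).Nontrivial := fun h => by
    obtain ⟨c, hc, h⟩ := eq_smul_of_edgeGerm hL hLp (edgeGerm_face hF (neg_ne_zero.2 hv) h) hB'
    exact neg_ne_smul hv hc h
  have hBn := nontrivial_of_mem_dualSegments hB.1
  obtain ⟨hgcd, hBorth⟩ := edgeVector_spec hBn hv hB.dot_eq
  obtain ⟨ω, hωe, c, hc, hωv⟩ : ∃ ω : ℤ × ℤ,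
      (ω = edgeVector (G.maxTerms p) ∨ ω = -edgeVector (G.maxTerms p)) ∧
      ∃ c : ℝ, 0 < c ∧ toPlane ω = c • v := by
    obtain ⟨c, hc, h⟩ := exists_edgeVector_eq_smul hBn hv hB.dot_eq
    rcases lt_or_gt_of_ne hc with hc | hc
    · refine ⟨-edgeVector (G.maxTerms p), Or.inr rfl, -c, neg_pos.2 hc, ?_⟩
      rw [neg_smul, ← h]
      simp [toPlane]
    · exact ⟨_, Or.inl rfl, c, hc, h⟩
  have hωgcd : Int.gcd ω.1 ω.2 = 1 := by
    rcases hωe with rfl | rfl <;> simpa using hgcd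
  have hωorth : ∀ a ∈ G.maxTerms p, ∀ b ∈ G.maxTerms p,
      ω.1 * (b.1 - a.1) + ω.2 * (b.2 - a.2) = 0 := by
    intro a ha b hb
    have := hBorth a ha b hb
    rcases hωe with rfl | rfl
    · exact this
    · simp only [Prod.fst_neg, Prod.snd_neg]; linarith
  -- the edges of `V(F)` on one side of the ray
  have hvn := cross_perp_ne_zero hv
  obtain ⟨s, A, hA, i₀, hi₀, j, hj, hji, hi₀A, hjA⟩ := hV.exists_edgeGerm hF hvn
  obtain ⟨s', A', hA', k₀, hk₀, -, -, -, hk₀A, -⟩ :=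
    IsVertex.exists_edgeGerm (v := -v) (n := (-v.2, v.1)) (F := F) (P := p) (by
      obtain ⟨i, hi, j, hj, h⟩ := hV
      exact ⟨i, hi, j, hj, by rwa [dot_neg, dot_neg, Ne, neg_inj]⟩) hF (by
      simp only [cross, Prod.fst_neg, Prod.snd_neg] at hvn ⊢
      intro h; apply hvn; linarith)
  rw [smul_neg, ← neg_smul] at hA'
  have hcr : ∀ r : ℝ, cross ((-v.2, v.1) + r • v) v ≠ 0 := by
    intro r
    have := cross_comb v (-v.2, v.1) 1 r 0 1
    simp only [one_smul, zero_smul, zero_add] at this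
    rw [this]
    simpa using hvn
  have hpos := hA.transverseMultiplicity_pos hB (hcr s)
  have hpos' := hA'.transverseMultiplicity_pos hB (hcr (-s'))
  -- `A` contains an exponent `i₀` of maximal height and `A'` an exponent `k₀` of minimal height.
  -- Two different edges on the side of `n` would give multiplicity at least two, so a single edge
  -- joins top and bottom.
  obtain rfl : A = A' := by
    by_contra hne
    have := transverseMultiplicity_add_le hvn hA hA' hB hne
    omega
  have hm : transverseMultiplicity A (G.maxTerms p) = 1 :=
    le_antisymm ((transverseMultiplicity_le hvn hA hB).trans hone) hpos
  unfold transverseMultiplicity at hm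
  rw [mul_eq_one, mul_eq_one] at hm
  obtain ⟨⟨hlA, hlB⟩, hdet⟩ := hm
  have hAd : (-v.2, v.1) + s • v ≠ 0 := by
    intro h
    apply hcr s
    rw [h]; simp [cross]
  obtain ⟨hgA, hAorth⟩ := edgeVector_spec (nontrivial_of_mem_dualSegments hA.1) hAd hA.dot_eq
  have hki : height ω k₀ < height ω i₀ := by
    rw [height_lt_iff hc hωv]
    have := (mem_face.1 hk₀).2 j hj
    rw [dot_neg, dot_neg] at this
    linarith
  -- By lattice length one, `k₀ - i₀` is `0` or plus or minus the primitive vector `α` turned by a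
  -- right angle. Its pairing with `β = ±ω` is then `0` or plus or minus the determinant, which is
  -- `±1`; `hki` fixes the value.
  have hk1 : height ω k₀ + 1 = height ω i₀ := by
    obtain ⟨k, hk, h1, h2⟩ := exists_coeff_of_latticeLength hgA (hAorth i₀ hi₀A k₀ hk₀A) hlA hi₀A hk₀A
    set α := edgeVector A
    set β := edgeVector (G.maxTerms p)
    have hD : α.1 * β.2 - α.2 * β.1 = 1 ∨ α.1 * β.2 - α.2 * β.1 = -1 := Int.natAbs_eq_iff.1 hdet
    have h3 : height β k₀ - height β i₀ = k * (α.1 * β.2 - α.2 * β.1) := by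
      unfold height; linear_combination β.1 * h1 + β.2 * h2
    have h4 : height ω k₀ - height ω i₀ = height β k₀ - height β i₀ ∨
        height ω k₀ - height ω i₀ = -(height β k₀ - height β i₀) := by
      rcases hωe with rfl | rfl
      · exact Or.inl rfl
      · right; simp only [height, Prod.fst_neg, Prod.snd_neg]; ring
    rcases hD with hD | hD <;> rw [hD] at h3 <;> omega
  have hcase : ∀ i ∈ F.maxTerms p, i = k₀ ∨ height ω i = height ω i₀ := by
    intro i hi
    have h1 : height ω i ≤ height ω i₀ := by
      rw [← not_lt, height_lt_iff hc hωv, not_lt]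
      exact (mem_face.1 hi₀).2 i hi
    have h2 : height ω k₀ ≤ height ω i := by
      rw [← not_lt, height_lt_iff hc hωv, not_lt]
      simpa [dot_neg] using (mem_face.1 hk₀).2 i hi
    by_contra hn
    push Not at hn
    -- Now `i` has the minimal height too, and together with `k₀` it would be dual to an edge in the
    -- direction `-v`.
    have h3 : ¬ height ω k₀ < height ω i := by omega
    rw [height_lt_iff hc hωv, not_lt] at h3
    refine hleft ⟨i, mem_face.2 ⟨hi, fun l hl => ?_⟩, k₀, hk₀, hn.1⟩
    have := (mem_face.1 hk₀).2 l hl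
    rw [dot_neg, dot_neg] at this ⊢
    linarith
  have hle : ∀ i ∈ F.support, height ω i ≤ height ω i₀ := by
    intro i hi
    rw [← not_lt, height_lt_iff hc hωv, not_lt]
    exact dot_le_of_mem_support hL hv hLp hi₀ hi
  obtain ⟨b₀, hb₀, b₁, hb₁, hf, hs⟩ : ∃ b₀ ∈ G.maxTerms p, ∃ b₁ ∈ G.maxTerms p,
      b₁.1 = b₀.1 - ω.2 ∧ b₁.2 = b₀.2 + ω.1 := by
    obtain ⟨a, ha, b, hb, hab⟩ := hBn
    obtain ⟨k, hk, h1, h2⟩ := exists_coeff_of_latticeLength hωgcd (hωorth a ha b hb) hlB ha hb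
    rcases hk with rfl | rfl | rfl
    · exact absurd (Prod.ext (by linarith) (by linarith)) hab
    · exact ⟨a, ha, b, hb, by linarith, by linarith⟩
    · exact ⟨b, hb, a, ha, by linarith, by linarith⟩
  have hωne : ω.1 ≠ 0 ∨ ω.2 ≠ 0 := by
    by_contra hn
    push Not at hn
    simp [hn.1, hn.2] at hωgcd
  have hBtwo : ∀ b ∈ G.maxTerms p, b = b₀ ∨ b = b₁ := by
    intro b hb
    obtain ⟨k, hk, h1, h2⟩ := exists_coeff_of_latticeLength hωgcd (hωorth _ hb₀ b hb) hlB hb₀ hb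
    obtain ⟨l, hl, h3, h4⟩ := exists_coeff_of_latticeLength hωgcd (hωorth _ hb₁ b hb) hlB hb₁ hb
    have hkl : k = l + 1 := by
      rcases hωne with h | h
      · exact mul_right_cancel₀ h (by linarith)
      · exact mul_right_cancel₀ h (by linarith)
    rcases hk with rfl | rfl | rfl
    · left; exact Prod.ext (by linarith) (by linarith)
    · right; exact Prod.ext (by linarith) (by linarith)
    · omega
  refine ⟨ω, b₀, b₁, i₀, k₀, hωgcd, ⟨c, hc, hωv⟩, hb₀, hb₁, hf, hs, hBtwo, (mem_face.1 hi₀).1,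
    (mem_face.1 hk₀).1, hk1, hcase, hle, fun i hi => ?_⟩
  rw [← not_lt, height_lt_iff hc hωv, not_lt]
  exact dot_le_of_mem_support hL' hv hLp (by rwa [← face_eq_self hB.dot_eq] at hb₀) hi

end TropPoly

/-! ### Differences of monomials -/

section

variable {k : Type*} [Field k] (val : AddValuation k (WithTop ℝ))

lemma le_val_mul {a b c : ℝ} {x y : k} (hx : (a : WithTop ℝ) ≤ val x) (hy : (b : WithTop ℝ) ≤ val y)
    (h : c = a + b) : (c : WithTop ℝ) ≤ val (x * y) := by
  rw [h, val.map_mul, WithTop.coe_add]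
  exact add_le_add hx hy

lemma le_val_pow {a : ℝ} {x : k} (hx : (a : WithTop ℝ) ≤ val x) (l : ℕ) :
    ((l * a : ℝ) : WithTop ℝ) ≤ val (x ^ l) := by
  induction l with
  | zero => simp
  | succ l ih =>
    rw [pow_succ]
    exact le_val_mul val ih hx (by push_cast; ring)

lemma val_zpow {Y : ℝ} {y : kˣ} (hy : val (y : k) = Y) (m : ℤ) :
    val ((y ^ m : kˣ) : k) = ((m * Y : ℝ) : WithTop ℝ) := by
  have hnat : ∀ n : ℕ, val ((y ^ n : kˣ) : k) = ((n * Y : ℝ) : WithTop ℝ) := by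
    intro n
    induction n with
    | zero => simp
    | succ n ih =>
      rw [pow_succ, Units.val_mul, val.map_mul, ih, hy, ← WithTop.coe_add]
      congr 1; push_cast; ring
  rcases Int.eq_nat_or_neg m with ⟨n, rfl | rfl⟩
  · rw [zpow_natCast, hnat]; simp
  · have h1 : val ((y ^ (-(n : ℤ)) : kˣ) : k) + val ((y ^ n : kˣ) : k) = 0 := by
      rw [← val.map_mul, ← Units.val_mul]
      simp
    rw [hnat] at h1
    have h2 : val ((y ^ (-(n : ℤ)) : kˣ) : k) ≠ ⊤ := by
      intro h; rw [h, WithTop.top_add] at h1; exact WithTop.top_ne_zero h1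
    obtain ⟨r, hr⟩ := WithTop.ne_top_iff_exists.1 h2
    rw [← hr] at h1 ⊢
    have h3 : r + n * Y = 0 := by exact_mod_cast h1
    congr 1
    push_cast
    linarith

variable {u u' : k} {y y' : kˣ} {U Y D E : ℝ}

lemma le_val_pow_sub_pow (hu : (U : WithTop ℝ) ≤ val u) (hu' : (U : WithTop ℝ) ≤ val u')
    (h : ((U + D : ℝ) : WithTop ℝ) ≤ val (u - u')) (l : ℕ) :
    ((l * U + D : ℝ) : WithTop ℝ) ≤ val (u ^ l - u' ^ l) := by
  induction l with
  | zero => simp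
  | succ l ih =>
    rw [show u ^ (l + 1) - u' ^ (l + 1) = u ^ l * (u - u') + (u ^ l - u' ^ l) * u' by ring]
    refine val.map_le_add (le_val_mul val (le_val_pow val hu l) h ?_) (le_val_mul val ih hu' ?_) <;>
    · push_cast; ring

lemma le_val_zpow_sub_zpow (hy : val (y : k) = Y) (hy' : val (y' : k) = Y)
    (h : ((Y + E : ℝ) : WithTop ℝ) ≤ val ((y : k) - y')) (m : ℤ) :
    ((m * Y + E : ℝ) : WithTop ℝ) ≤ val (((y ^ m : kˣ) : k) - ((y' ^ m : kˣ) : k)) := by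
  rcases Int.eq_nat_or_neg m with ⟨n, rfl | rfl⟩
  · simpa using le_val_pow_sub_pow val hy.ge hy'.ge h n
  · have h1 := le_val_pow_sub_pow val hy'.ge hy.ge (D := E) (by rwa [val.map_sub_swap]) n
    have h2 : ((y ^ (-(n : ℤ)) : kˣ) : k) - ((y' ^ (-(n : ℤ)) : kˣ) : k) =
        ((y' : k) ^ n - (y : k) ^ n) * (((y ^ (-(n : ℤ)) : kˣ) : k) * ((y' ^ (-(n : ℤ)) : kˣ) : k)) := by
      simp only [zpow_neg, zpow_natCast, Units.val_inv_eq_inv_val, Units.val_pow_eq_pow_val]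
      have := y.ne_zero
      have := y'.ne_zero
      field_simp
    rw [h2]
    refine le_val_mul val h1 (le_val_mul val (val_zpow val hy _).ge (val_zpow val hy' _).ge rfl) ?_
    push_cast; ring

lemma le_val_monomial_sub (hu : (U : WithTop ℝ) ≤ val u) (hu' : (U : WithTop ℝ) ≤ val u')
    (hy : val (y : k) = Y) (hy' : val (y' : k) = Y)
    (h : ((U + D : ℝ) : WithTop ℝ) ≤ val (u - u'))
    (h' : ((Y + D : ℝ) : WithTop ℝ) ≤ val ((y : k) - y')) (l : ℕ) (m : ℤ) :
    ((l * U + m * Y + D : ℝ) : WithTop ℝ) ≤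
      val (u ^ l * ((y ^ m : kˣ) : k) - u' ^ l * ((y' ^ m : kˣ) : k)) := by
  rw [show u ^ l * ((y ^ m : kˣ) : k) - u' ^ l * ((y' ^ m : kˣ) : k) =
    u ^ l * (((y ^ m : kˣ) : k) - ((y' ^ m : kˣ) : k)) + (u ^ l - u' ^ l) * ((y' ^ m : kˣ) : k) by
      ring]
  refine val.map_le_add
    (le_val_mul val (le_val_pow val hu l) (le_val_zpow_sub_zpow val hy hy' h' m) ?_)
    (le_val_mul val (le_val_pow_sub_pow val hu hu' h l) (val_zpow val hy' m).ge ?_) <;> ring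

variable {S : Finset (ℤ × ℤ)} {l : ℤ × ℤ → ℕ} {m : ℤ × ℤ → ℤ} {c : ℤ × ℤ → k} {γ : ℤ × ℤ → ℝ}

lemma sum_monomial_sub_eq_zero
    (h0 : ∑ i ∈ S, c i * (u ^ l i * ((y ^ m i : kˣ) : k)) = 0)
    (h0' : ∑ i ∈ S, c i * (u' ^ l i * ((y' ^ m i : kˣ) : k)) = 0) :
    ∑ i ∈ S, c i * (u ^ l i * ((y ^ m i : kˣ) : k) - u' ^ l i * ((y' ^ m i : kˣ) : k)) = 0 := by
  simp only [mul_sub, Finset.sum_sub_distrib, h0, h0', sub_zero]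

lemma lt_val_mul_of_lt {a b : ℝ} {x y : k} (hx : val x = a)
    (h : ((a + b : ℝ) : WithTop ℝ) < val (x * y)) : (b : WithTop ℝ) < val y := by
  rw [val.map_mul, hx, WithTop.coe_add] at h
  exact lt_of_add_lt_add_left h

/-- If `1` and `y` are the dominant monomials of a polynomial, then the `y`-coordinates of two of its
zeros are closer to each other than the `u`-coordinates. -/
lemma lt_val_sub_of_dominant_pair (hc : ∀ i ∈ S, val (c i) = γ i)
    (hu : (U : WithTop ℝ) ≤ val u) (hu' : (U : WithTop ℝ) ≤ val u')
    (hy : val (y : k) = Y) (hy' : val (y' : k) = Y)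
    (h : ((U + D : ℝ) : WithTop ℝ) ≤ val (u - u'))
    (h' : ((Y + D : ℝ) : WithTop ℝ) ≤ val ((y : k) - y'))
    (h0 : ∑ i ∈ S, c i * (u ^ l i * ((y ^ m i : kˣ) : k)) = 0)
    (h0' : ∑ i ∈ S, c i * (u' ^ l i * ((y' ^ m i : kˣ) : k)) = 0)
    {b₀ b₁ : ℤ × ℤ} (hb₁ : b₁ ∈ S) (hlb₀ : l b₀ = 0) (hmb₀ : m b₀ = 0)
    (hlb₁ : l b₁ = 0) (hmb₁ : m b₁ = 1)
    (hdom : ∀ i ∈ S, i ≠ b₀ → i ≠ b₁ → γ b₁ + l b₁ * U + m b₁ * Y < γ i + l i * U + m i * Y) :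
    ((Y + D : ℝ) : WithTop ℝ) < val ((y : k) - y') := by
  have hsum := sum_monomial_sub_eq_zero h0 h0'
  rw [← Finset.add_sum_erase S _ hb₁, add_eq_zero_iff_eq_neg] at hsum
  refine lt_val_mul_of_lt val (hc b₁ hb₁) (x := c b₁) ?_
  simp only [hlb₁, hmb₁, pow_zero, zpow_one, one_mul] at hsum
  rw [hsum, val.map_neg]
  refine val.map_lt_sum (WithTop.coe_ne_top) fun i hi => ?_
  obtain ⟨hib, hiS⟩ := Finset.mem_erase.1 hi
  -- The term of `b₀` is constant and cancels in the difference; all others are strictly dominated.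
  by_cases hi0 : i = b₀
  · subst hi0
    simp [hlb₀, hmb₀]
  · refine lt_of_lt_of_le ?_ (le_val_mul val (hc i hiS).ge
      (le_val_monomial_sub val hu hu' hy hy' h h' (l i) (m i)) rfl)
    have := hdom i hiS hi0 hib
    rw [hlb₁, hmb₁] at this
    rw [WithTop.coe_lt_coe]
    push_cast at this
    linarith

/-- If a polynomial has, among its dominant monomials, only one that involves `u`, and this one is
linear in `u`, then the `u`-coordinates of two of its zeros are not further apart than the
`y`-coordinates. -/
lemma lt_val_sub_of_dominant_linear (hc : ∀ i ∈ S, val (c i) = γ i)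
    (hu : (U : WithTop ℝ) ≤ val u) (hu' : (U : WithTop ℝ) ≤ val u')
    (hy : val (y : k) = Y) (hy' : val (y' : k) = Y)
    (h : ((U + D : ℝ) : WithTop ℝ) ≤ val (u - u'))
    (h' : ((Y + D : ℝ) : WithTop ℝ) < val ((y : k) - y'))
    (h0 : ∑ i ∈ S, c i * (u ^ l i * ((y ^ m i : kˣ) : k)) = 0)
    (h0' : ∑ i ∈ S, c i * (u' ^ l i * ((y' ^ m i : kˣ) : k)) = 0)
    {i₁ : ℤ × ℤ} (hi₁ : i₁ ∈ S) (hl : l i₁ = 1)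
    (hle : ∀ i ∈ S, γ i₁ + l i₁ * U + m i₁ * Y ≤ γ i + l i * U + m i * Y)
    (hdom : ∀ i ∈ S, i ≠ i₁ → l i ≠ 0 →
      γ i₁ + l i₁ * U + m i₁ * Y < γ i + l i * U + m i * Y) :
    ((U + D : ℝ) : WithTop ℝ) < val (u - u') := by
  -- `E` records the strict gain for `y` as a real number; if `y = y'`, any `E > D` would do.
  obtain ⟨E, hDE, hE⟩ : ∃ E : ℝ, D < E ∧ ((Y + E : ℝ) : WithTop ℝ) ≤ val ((y : k) - y') := by
    cases hv : val ((y : k) - y') with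
    | top => exact ⟨D + 1, by linarith, le_top⟩
    | coe r =>
      rw [hv, WithTop.coe_lt_coe] at h'
      exact ⟨r - Y, by linarith, by rw [add_sub_cancel]⟩
  have hsum := sum_monomial_sub_eq_zero h0 h0'
  rw [← Finset.add_sum_erase S _ hi₁] at hsum
  simp only [hl, pow_one] at hsum
  -- Split `u y^m - u' y'^m = y^m (u - u') + u' (y^m - y'^m)` and isolate the first summand. The
  -- second, like the terms free of `u`, gains from `E`.
  have hsum' : c i₁ * (((y ^ m i₁ : kˣ) : k) * (u - u')) =
      -(c i₁ * (u' * (((y ^ m i₁ : kˣ) : k) - ((y' ^ m i₁ : kˣ) : k))) +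
      ∑ i ∈ S.erase i₁, c i * (u ^ l i * ((y ^ m i : kˣ) : k) - u' ^ l i * ((y' ^ m i : kˣ) : k))) := by
    linear_combination hsum
  refine lt_val_mul_of_lt val (val_zpow val hy (m i₁)) (lt_val_mul_of_lt val (hc i₁ hi₁) ?_)
  rw [hsum', val.map_neg]
  refine val.map_lt_add ?_ (val.map_lt_sum WithTop.coe_ne_top fun i hi => ?_)
  · refine lt_of_lt_of_le ?_ (le_val_mul val (hc i₁ hi₁).ge (le_val_mul val hu'
      (le_val_zpow_sub_zpow val hy hy' hE (m i₁)) rfl) rfl)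
    rw [WithTop.coe_lt_coe]
    linarith
  · obtain ⟨hne, hiS⟩ := Finset.mem_erase.1 hi
    have h1 := hle i hiS
    rw [hl, Nat.cast_one] at h1
    by_cases hl0 : l i = 0
    · rw [hl0, pow_zero, pow_zero, one_mul, one_mul]
      refine lt_of_lt_of_le ?_ (le_val_mul val (hc i hiS).ge
        (le_val_zpow_sub_zpow val hy hy' hE (m i)) rfl)
      rw [WithTop.coe_lt_coe]
      rw [hl0, Nat.cast_zero] at h1
      linarith
    · refine lt_of_lt_of_le ?_ (le_val_mul val (hc i hiS).ge
        (le_val_monomial_sub val hu hu' hy hy' h h'.le (l i) (m i)) rfl)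
      have := hdom i hiS hne hl0
      rw [hl, Nat.cast_one] at this
      rw [WithTop.coe_lt_coe]
      linarith

/-- The `u`-coordinates agree if no bound on the distances is sharp. -/
lemma eq_of_forall_lt_val_sub
    (hg : ∀ D : ℝ, ((U + D : ℝ) : WithTop ℝ) ≤ val (u - u') →
      ((Y + D : ℝ) : WithTop ℝ) ≤ val ((y : k) - y') →
      ((Y + D : ℝ) : WithTop ℝ) < val ((y : k) - y'))
    (hf : ∀ D : ℝ, ((U + D : ℝ) : WithTop ℝ) ≤ val (u - u') →
      ((Y + D : ℝ) : WithTop ℝ) < val ((y : k) - y') →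
      ((U + D : ℝ) : WithTop ℝ) < val (u - u')) : u = u' := by
  by_contra hne
  have hfin : val (u - u') ≠ ⊤ := fun h => hne (sub_eq_zero.1 (val.top_iff.1 h))
  obtain ⟨r, hr⟩ := WithTop.ne_top_iff_exists.1 hfin
  rw [← hr] at hg hf
  -- Take the largest `D` that is a bound for both coordinates, and contradict its sharpness in the
  -- coordinate that attains it.
  rcases le_or_gt (((Y + (r - U) : ℝ)) : WithTop ℝ) (val ((y : k) - y')) with h | h
  · have h1 : ((U + (r - U) : ℝ) : WithTop ℝ) ≤ r := by rw [add_sub_cancel]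
    have := hf (r - U) h1 (hg _ h1 h)
    rw [add_sub_cancel] at this
    exact lt_irrefl _ this
  · obtain ⟨q, hq⟩ := WithTop.ne_top_iff_exists.1 h.ne_top
    rw [← hq] at hg h
    rw [WithTop.coe_lt_coe] at h
    have := hg (q - Y) (by rw [WithTop.coe_le_coe]; linarith) (by rw [add_sub_cancel])
    rw [add_sub_cancel] at this
    exact lt_irrefl _ this

/-! ### Zeros of Laurent polynomials along a ray -/

/-- The value at `z` of the monomial with exponent `i`. -/
def monomialUnit (z : kˣ × kˣ) (i : ℤ × ℤ) : kˣ := z.1 ^ i.1 * z.2 ^ i.2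

lemma val_unit (y : kˣ) : val (y : k) = (((val (y : k)).untopD 0 : ℝ) : WithTop ℝ) := by
  have : val (y : k) ≠ ⊤ := fun h => y.ne_zero (val.top_iff.1 h)
  obtain ⟨r, hr⟩ := WithTop.ne_top_iff_exists.1 this
  simp [← hr]

lemma val_monomialUnit (z : kˣ × kˣ) (i : ℤ × ℤ) :
    val (monomialUnit z i : k) = ((-dot i (trop val z) : ℝ) : WithTop ℝ) := by
  rw [monomialUnit, Units.val_mul, val.map_mul, val_zpow val (val_unit val z.1),
    val_zpow val (val_unit val z.2), ← WithTop.coe_add]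
  congr 1
  simp only [dot, trop]; ring

lemma mem_support_tropPoly {f : Laurent k} {i : ℤ × ℤ} :
    i ∈ (tropPoly val f).support ↔ i ∈ f.coeff.support := by
  rw [TropPoly.mem_support, Finsupp.mem_support_iff]
  by_cases h : f.coeff i = 0 <;> simp [tropPoly, h]

lemma val_coeff {f : Laurent k} {i : ℤ × ℤ} (hi : i ∈ f.coeff.support) (p : ℝ × ℝ) :
    val (f.coeff i) = ((dot i p - (tropPoly val f).realTerm i p : ℝ) : WithTop ℝ) := by
  rw [Finsupp.mem_support_iff] at hi
  have : val (f.coeff i) ≠ ⊤ := fun h => hi (val.top_iff.1 h)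
  obtain ⟨r, hr⟩ := WithTop.ne_top_iff_exists.1 this
  simp [TropPoly.realTerm, tropPoly, hi, ← hr]

/-- Evaluation in terms of monomials with exponents `η` and `w`, after division by the monomial with
exponent `b`. -/
lemma sum_eq_zero_of_evalAt {f : Laurent k} {z : kˣ × kˣ} (hz : evalAt f z = 0) {b η w : ℤ × ℤ}
    {l : ℤ × ℤ → ℕ} {m : ℤ × ℤ → ℤ}
    (h : ∀ i ∈ f.coeff.support, i.1 = b.1 + l i * η.1 + m i * w.1 ∧
      i.2 = b.2 + l i * η.2 + m i * w.2) :
    ∑ i ∈ f.coeff.support, f.coeff i *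
      ((monomialUnit z η : k) ^ l i * ((monomialUnit z w ^ m i : kˣ) : k)) = 0 := by
  have hb := (monomialUnit z b).ne_zero
  apply mul_left_cancel₀ hb
  rw [mul_zero, ← hz, evalAt, Finsupp.sum, Finset.mul_sum]
  refine Finset.sum_congr rfl fun i hi => ?_
  have key : z.1 ^ i.1 * z.2 ^ i.2 =
      monomialUnit z b * (monomialUnit z η ^ l i * monomialUnit z w ^ m i) := by
    obtain ⟨h1, h2⟩ := h i hi
    rw [h1, h2]
    simp only [monomialUnit, mul_zpow, ← zpow_natCast, ← zpow_mul, zpow_add, mul_comm η.1,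
      mul_comm η.2, mul_comm w.1, mul_comm w.2]
    simp only [mul_assoc, mul_left_comm, mul_comm]
  rw [key]
  push_cast
  ring

end

section

variable {k : Type*} [Field k] (val : AddValuation k (WithTop ℝ))

open TropPoly in
/-- Common zeros along a ray on which the curves have the local model of multiplicity one. -/
lemma trop_eq_of_localModel {f g : Laurent k} {p v : ℝ × ℝ} {ω b₀ b₁ i₀ k₀ : ℤ × ℤ}
    (h : LocalModel (tropPoly val f) (tropPoly val g) p v ω b₀ b₁ i₀ k₀)
    {z z' : kˣ × kˣ} (hz : z ∈ zeroLocus f g) (hz' : z' ∈ zeroLocus f g) {r r' : ℝ}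
    (hr : 0 ≤ r) (hr' : 0 ≤ r') (hzr : trop val z = p + r • v) (hzr' : trop val z' = p + r' • v) :
    trop val z = trop val z' := by
  -- By Bézout, `η` pairs to `-1` with `ω`, while `w` is orthogonal to it; `η, w` is a basis of
  -- `ℤ²`. The coordinates `u` and `y` are the monomials with these exponents.
  obtain ⟨c, hc, hωv⟩ := h.parallel
  obtain ⟨s, t, hst⟩ := Int.isCoprime_iff_gcd_eq_one.2 h.primitive
  set η : ℤ × ℤ := (-s, -t) with hη
  set w : ℤ × ℤ := (-ω.2, ω.1) with hw
  have hωv₁ : (ω.1 : ℝ) = c * v.1 := congrArg Prod.fst hωv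
  have hωv₂ : (ω.2 : ℝ) = c * v.2 := congrArg Prod.snd hωv
  have hηv : c * dot η v = -1 := by
    have : (s * ω.1 + t * ω.2 : ℝ) = 1 := by exact_mod_cast hst
    simp only [dot, hη]; push_cast
    linear_combination -this + s * hωv₁ + t * hωv₂
  have hwv : dot w v = 0 := by
    apply mul_left_cancel₀ hc.ne'
    simp only [dot, hw]; push_cast
    linear_combination ω.2 * hωv₁ - ω.1 * hωv₂
  have hηneg : dot η v < 0 := by
    by_contra hn
    have := mul_nonneg hc.le (not_lt.1 hn)
    linarith
  -- the exponents in terms of `η` and `w`, relative to a base point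
  let l : ℤ × ℤ → ℤ × ℤ → ℕ := fun b i => (height ω b - height ω i).toNat
  let m : ℤ × ℤ → ℤ × ℤ → ℤ := fun b i => s * (i.2 - b.2) - t * (i.1 - b.1)
  have hlm : ∀ b i, height ω i ≤ height ω b →
      i.1 = b.1 + l b i * η.1 + m b i * w.1 ∧ i.2 = b.2 + l b i * η.2 + m b i * w.2 := by
    intro b i hbi
    have hl : (l b i : ℤ) = height ω b - height ω i := Int.toNat_of_nonneg (by omega)
    rw [hl]
    simp only [m, hη, hw, height]
    exact ⟨by linear_combination (-(i.1 - b.1)) * hst, by linear_combination (-(i.2 - b.2)) * hst⟩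
  -- With the weights `U` and `Y` read off at `p`, a term of larger tropical value at `p` has
  -- smaller valuation, so `maxTerms` describes the dominant monomials.
  have hweight : ∀ (F : TropPoly) b i, height ω i ≤ height ω b →
      dot i p - F.realTerm i p + l b i * (-dot η p) + m b i * (-dot w p) =
        dot b p - F.realTerm i p := by
    intro F b i hbi
    obtain ⟨h1, h2⟩ := hlm b i hbi
    have h1' : (i.1 : ℝ) = b.1 + l b i * η.1 + m b i * w.1 := by exact_mod_cast h1
    have h2' : (i.2 : ℝ) = b.2 + l b i * η.2 + m b i * w.2 := by exact_mod_cast h2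
    simp only [dot]
    linear_combination p.1 * h1' + p.2 * h2'
  -- Moving along the ray only raises `val u`, so its value at `p` bounds it for every zero over
  -- `L`.
  have hu : ∀ {z : kˣ × kˣ} {r : ℝ}, trop val z = p + r • v → 0 ≤ r →
      ((-dot η p : ℝ) : WithTop ℝ) ≤ val (monomialUnit z η : k) := by
    intro z r hzr hr
    rw [val_monomialUnit, hzr, WithTop.coe_le_coe, dot_add, dot_smul]
    have := mul_nonneg hr (neg_nonneg.2 hηneg.le)
    linarith
  have hy : ∀ {z : kˣ × kˣ} {r : ℝ}, trop val z = p + r • v →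
      val (monomialUnit z w : k) = ((-dot w p : ℝ) : WithTop ℝ) := by
    intro z r hzr
    rw [val_monomialUnit, hzr, dot_add, dot_smul, hwv, mul_zero, add_zero]
  have hleF : ∀ i ∈ f.coeff.support, height ω i ≤ height ω i₀ := fun i hi =>
    h.height_le i ((mem_support_tropPoly val).2 hi)
  have hleG : ∀ i ∈ g.coeff.support, height ω i ≤ height ω b₀ := fun i hi =>
    h.height_le' i ((mem_support_tropPoly val).2 hi)
  have hb₁S : b₁ ∈ g.coeff.support :=
    (mem_support_tropPoly val).1 (mem_maxTerms.1 h.mem_b₁).1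
  have hk₀S : k₀ ∈ f.coeff.support :=
    (mem_support_tropPoly val).1 (mem_maxTerms.1 h.mem_k₀).1
  have hb₁h : height ω b₁ = height ω b₀ := by
    simp only [height, h.b₁_fst, h.b₁_snd]; ring
  have huu : (monomialUnit z η : k) = monomialUnit z' η := by
    refine eq_of_forall_lt_val_sub val (U := -dot η p) (Y := -dot w p) (y := monomialUnit z w)
      (y' := monomialUnit z' w) (fun D h1 h2 => ?_) (fun D h1 h2 => ?_)
    · refine lt_val_sub_of_dominant_pair val (S := g.coeff.support) (l := l b₀) (m := m b₀)
        (c := g.coeff) (γ := fun i => dot i p - (tropPoly val g).realTerm i p)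
        (b₀ := b₀) (b₁ := b₁) (fun i hi => val_coeff val hi p) (hu hzr hr) (hu hzr' hr') (hy hzr)
        (hy hzr') h1 h2 (sum_eq_zero_of_evalAt hz.2 fun i hi => hlm b₀ i (hleG i hi))
        (sum_eq_zero_of_evalAt hz'.2 fun i hi => hlm b₀ i (hleG i hi)) hb₁S ?_ ?_ ?_ ?_ ?_
      · simp [l]
      · simp [m]
      · simp [l, hb₁h]
      · simp only [m, h.b₁_fst, h.b₁_snd]; linarith
      · intro i hi hib₀ hib₁
        rw [hweight _ _ _ (hleG i hi), hweight _ _ _ hb₁h.le]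
        have := realTerm_lt ((mem_support_tropPoly val).2 hi)
          (fun hm => (h.eq_or_eq i hm).elim hib₀ hib₁) h.mem_b₁
        linarith
    · have hk₀l : l i₀ k₀ = 1 := by
        have := h.height_k₀
        simp only [l]; omega
      refine lt_val_sub_of_dominant_linear val (S := f.coeff.support) (l := l i₀) (m := m i₀)
        (c := f.coeff) (γ := fun i => dot i p - (tropPoly val f).realTerm i p)
        (i₁ := k₀) (fun i hi => val_coeff val hi p) (hu hzr hr) (hu hzr' hr') (hy hzr)
        (hy hzr') h1 h2 (sum_eq_zero_of_evalAt hz.1 fun i hi => hlm i₀ i (hleF i hi))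
        (sum_eq_zero_of_evalAt hz'.1 fun i hi => hlm i₀ i (hleF i hi)) hk₀S hk₀l ?_ ?_
      · intro i hi
        rw [hweight _ _ _ (hleF i hi), hweight _ _ _ (hleF _ hk₀S)]
        have := (mem_maxTerms.1 h.mem_k₀).2 i ((mem_support_tropPoly val).2 hi)
        linarith
      · intro i hi hik hl
        rw [hweight _ _ _ (hleF i hi), hweight _ _ _ (hleF _ hk₀S)]
        have := realTerm_lt ((mem_support_tropPoly val).2 hi)
          (fun hm => (h.eq_or_height_eq i hm).elim hik fun he => hl (by simp [l, he])) h.mem_k₀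
        linarith
  -- Since `dot η v ≠ 0`, the valuation of `u` determines the parameter on the ray.
  have hval := congrArg val huu
  rw [val_monomialUnit, val_monomialUnit, hzr, hzr', WithTop.coe_inj, neg_inj, dot_add, dot_add,
    dot_smul, dot_smul, add_right_inj] at hval
  rw [hzr, hzr', mul_right_cancel₀ hηneg.ne hval]

end

end TropicalCurve

end

theorem corollary4p2 {k : Type*} [Field k] [IsAlgClosed k]
    (val : AddValuation k (WithTop ℝ)) (hval : ∃ a : k, a ≠ 0 ∧ val a ≠ 0)
    (f g : TropicalCurve.Laurent k) (L : Set (ℝ × ℝ))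
    (hL : L ∈ TropicalCurve.raysOne (TropicalCurve.tropPoly val f) (TropicalCurve.tropPoly val g)) :
    ((TropicalCurve.trop val '' TropicalCurve.zeroLocus f g) ∩ L).Subsingleton := by
  obtain ⟨p, v, hv, hLp⟩ := hL.1
  rintro _ ⟨⟨z, hz, rfl⟩, hzL⟩ _ ⟨⟨z', hz', rfl⟩, hzL'⟩
  rw [hLp] at hzL hzL'
  obtain ⟨r, hr, hzr⟩ := hzL
  obtain ⟨r', hr', hzr'⟩ := hzL'
  rcases TropicalCurve.TropPoly.isVertex_or_isVertex hL hv hLp with hV | hV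
  · obtain ⟨ω, b₀, b₁, i₀, k₀, h⟩ := TropicalCurve.TropPoly.exists_localModel hL hv hLp hV
    exact TropicalCurve.trop_eq_of_localModel val h hz hz' hr hr' hzr hzr'
  · obtain ⟨ω, b₀, b₁, i₀, k₀, h⟩ := TropicalCurve.TropPoly.exists_localModel
      (TropicalCurve.TropPoly.raysOne_comm hL) hv hLp hV
    exact TropicalCurve.trop_eq_of_localModel val h hz.symm hz'.symm hr hr' hzr hzr'
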